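/- **Setting.** Let $\Omega\subset\mathbb R^2$ be a bounded connected open polygonal domain (the interior of a finite union of convex polygons), with boundary $\partial\Omega=\Gamma^D\cup\Gamma^N$, where $\Gamma^D\cap\Gamma^N$ has zero length. Let $V\in C^1(\overline\Omega)$, $\rho>0$, let $u^D=\rho e^{-V}$ on $\Gamma^D$ (thermal equilibrium), and let $u_0\in L^2(\Omega)$, $u_0\ge 0$. An *admissible mesh* consists of finitely many pairwise disjoint open convex polygons $K\in\mathcal T$ contained in $\Omega$, the closures of which cover $\overline\Omega$, of a finite set $\mathcal E$ of nondegenerate segments (edges) which meet at most at their end points, and of points $x_K\in K$, such that: $\partial K$ is the union of a set $\mathcal E_K$ of edges; each edge is either an interior edge $\sigma=K|L$, with $\overline K\cap\overline L=\sigma$, which belongs exactly to $\mathcal E_K$ and $\mathcal E_L$, or a boundary edge $\sigma\subset\partial\Omega$, which belongs to exactly one $\mathcal E_K$; two distinct control volumes without a common edge have closures meeting in a set of zero length; for $\sigma=K|L$ the line through $x_K$ and $x_L$ is orthogonal to $\sigma$; for a boundary edge $\sigma\in\mathcal E_K$ the line through $x_K$ orthogonal to $\sigma$ meets $\sigma$;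 each boundary edge is, up to its end points, included in $\Gamma^D$ (Dirichlet edges, $\sigma\in\mathcal E^D_{\rm ext}$) or in $\Gamma^N$. Denote by $m_K$ the area of $K$, by $m_\sigma$ and $x_\sigma$ the length and the midpoint of $\sigma$, by $d(x_K,\sigma)$ the distance from $x_K$ to the line containing $\sigma$; set $d_\sigma=|x_K-x_L|$ if $\sigma=K|L$, $d_\sigma=d(x_K,\sigma)$ if $\sigma\in\mathcal E_K$ is a boundary edge, and $\tau_\sigma=m_\sigma/d_\sigma$. The mesh is *$\zeta$-regular* ($\zeta>0$) if $d(x_K,\sigma)\ge\zeta d_\sigma$ for all $K\in\mathcal T$ and $\sigma\in\mathcal E_K$. Let $r:(0,\infty)^2\to(0,\infty)$ be nondecreasing in each variable, symmetric, positively homogeneous of degree $1$, with $r(x,x)=x$ and $\frac{x-y}{\log x-\log y}\le r(x,y)\le\max(x,y)$ for $x\ne y$. For a vector $v$ of values $v_K$ ($K\in\mathcal T$) and $v_\sigma$ ($\sigma\in\mathcal E^D_{\rm ext}$), and for $\sigma\in\mathcal E_K$, put $v_{K,\sigma}=v_L$ if $\sigma=K|L$, $v_{K,\sigma}=v_\sigma$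 if $\sigma$ is a Dirichlet edge, $v_{K,\sigma}=v_K$ if $\sigma$ is another boundary edge, and $D_{K,\sigma}v=v_{K,\sigma}-v_K$. With $V_K=V(x_K)$, $V_\sigma=V(x_\sigma)$ and the time step $\Delta t>0$, a *solution of the nonlinear TPFA scheme* is a sequence $(u_K^n)_{K\in\mathcal T,\,n\ge0}$ with $u_K^0=\frac1{m_K}\int_K u_0$, and, for all $n\ge0$ and $K\in\mathcal T$, $u_K^{n+1}>0$ and $$m_K\frac{u_K^{n+1}-u_K^n}{\Delta t}-\sum_{\sigma\in\mathcal E_K}\tau_\sigma\, r\big(u_K^{n+1},u_{K,\sigma}^{n+1}\big)\,D_{K,\sigma}(\log u^{n+1}+V)=0,\qquad u_\sigma^{n+1}=u^D(x_\sigma)\ \text{ for }\sigma\in\mathcal E^D_{\rm ext}.$$ The discrete equilibrium is $u_K^\infty=\rho e^{-V_K}$, $u_\sigma^\infty=\rho e^{-V_\sigma}$. For $p\in(1,2]$ let $\Phi_p(s)=\frac{s^p-ps}{p-1}+1$ and $\mathbb E_p^n=\sum_{K\in\mathcal T}m_K\,u_K^\infty\,\Phi_p(u_K^n/u_K^\infty)$.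 **Theorem 3.2.** For all $\Omega$ and $\Gamma^D$ there is a constant $C_P>0$, depending only on $\Omega$ and $\Gamma^D$, with the following property. Let $p\in(1,2]$, $\zeta>0$, $V$, $\rho$, $\Gamma^N$, $u^D$, $u_0$, $r$ and $\Delta t>0$ be as above, consider a $\zeta$-regular admissible mesh with $\mathcal E^D_{\rm ext}\ne\emptyset$, and let $m^\infty,M^\infty>0$ be such that $m^\infty\le u_K^\infty\le M^\infty$ for all $K\in\mathcal T$ and $m^\infty\le u_\sigma^\infty$ for all $\sigma\in\mathcal E^D_{\rm ext}$. Set $$\kappa_p=\frac{4(p-1)}{p}\,\frac{\zeta}{C_P^2}\left(\frac{m^\infty}{M^\infty}\right)^p>0 .$$ Then every solution of the scheme satisfies $$\mathbb E_p^n\le(1+\kappa_p\Delta t)^{-n}\,\mathbb E_p^0\qquad\text{for all }n\ge0,$$ and, for every $k>0$ with $\Delta t\le k$, $$\mathbb E_p^n\le e^{-\tilde\kappa_p\,n\Delta t}\,\mathbb E_p^0\quad\text{for all }n\ge0,\qquad \tilde\kappa_p=\frac{\log(1+\kappa_p k)}{k}.$$ Moreover there are $m^\infty,M^\infty>0$ depending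 only on $\Omega$, $V$ and $\rho$ with $m^\infty\le\rho e^{-V}\le M^\infty$ on $\overline\Omega$, so that $\kappa_p$ can be chosen to depend only on $p$, $\Omega$, $\Gamma^D$, $\zeta$, $u^D$ and $V$. -/

import Mathlib

open MeasureTheory
open scoped Classical

noncomputable section

namespace TPFA

/-- The Euclidean plane `ℝ²`. -/
abbrev Plane : Type := EuclideanSpace ℝ (Fin 2)

/-- A polygonal domain: a (nonempty) connected set which is the interior of a finite union of
(closed, convex) polygons.  Such a set is automatically open and bounded. -/
def IsPolygonalDomain (Ω : Set Plane) : Prop :=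
  IsConnected Ω ∧
    ∃ S : Finset (Finset Plane), Ω = interior (⋃ s ∈ S, convexHull ℝ (s : Set Plane))

/-- `V ∈ C¹(closure Ω)`: `V` is `C¹` in `Ω`, and `V` and its differential extend continuously to
the closure of `Ω` (the extension of `V` being `V` itself). -/
def IsC1UpToBoundary (Ω : Set Plane) (V : Plane → ℝ) : Prop :=
  ContDiffOn ℝ 1 V Ω ∧ ContinuousOn V (closure Ω) ∧
    ∃ G : Plane → (Plane →L[ℝ] ℝ), ContinuousOn G (closure Ω) ∧ ∀ x ∈ Ω, fderiv ℝ V x = G x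

/-- The boundary of `Ω` is divided into the two parts `ΓD` and `ΓN` (the common end points of the
two parts may be attributed to either or to both of them). -/
def IsBoundarySplitting (Ω ΓD ΓN : Set Plane) : Prop :=
  ΓD ∪ ΓN = frontier Ω ∧ Measure.hausdorffMeasure 1 (ΓD ∩ ΓN) = 0

/-- An admissible finite volume mesh `(𝒯, ℰ, 𝒫)` of `Ω`, compatible with the splitting of the
boundary into `ΓD` and `ΓN`.  The control volumes are indexed by `T` and the edges by `E`.
An edge `σ` has end points `a σ` and `b σ`.  An interior edge `σ = K|L` has `cell₁ σ = K` and
`cell₂ σ = some L` (in an arbitrary order); a boundary edge `σ` of the control volume `K` has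
`cell₁ σ = K` and `cell₂ σ = none`. -/
structure AdmissibleMesh (Ω ΓD ΓN : Set Plane) (T E : Type) where
  /-- the control volumes -/
  cell : T → Set Plane
  /-- the points `x_K` -/
  center : T → Plane
  /-- first end point of an edge -/
  a : E → Plane
  /-- second end point of an edge -/
  b : E → Plane
  /-- a control volume having `σ` as an edge -/
  cell₁ : E → T
  /-- the other control volume having `σ` as an edge, if any -/
  cell₂ : E → Option T
  /-- control volumes are open convex polygons -/
  cell_polygon : ∀ K, ∃ s : Finset Plane, cell K = interior (convexHull ℝ (s : Set Plane))
  cell_subset : ∀ K, cell K ⊆ Ω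
  cell_disjoint : ∀ K L, K ≠ L → Disjoint (cell K) (cell L)
  /-- the control volumes cover the domain -/
  closure_cells : closure (⋃ K, cell K) = closure Ω
  /-- edges have positive length -/
  a_ne_b : ∀ σ, a σ ≠ b σ
  /-- distinct edges can only meet at end points -/
  edge_disjoint : ∀ σ τ, σ ≠ τ → Disjoint (openSegment ℝ (a σ) (b σ)) (openSegment ℝ (a τ) (b τ))
  cell₂_ne : ∀ σ, cell₂ σ ≠ some (cell₁ σ)
  /-- the boundary of a control volume is the union of its edges -/
  frontier_cell : ∀ K, frontier (cell K) =
    ⋃ σ ∈ {σ : E | cell₁ σ = K ∨ cell₂ σ = some K}, segment ℝ (a σ) (b σ)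
  /-- an interior edge `σ = K|L` is the common part of the boundaries of `K` and `L` -/
  interior_edge : ∀ σ L, cell₂ σ = some L →
    closure (cell (cell₁ σ)) ∩ closure (cell L) = segment ℝ (a σ) (b σ)
  /-- two control volumes either share an edge, or their closures meet in a set of length zero -/
  conformity : ∀ K L, K ≠ L →
    Measure.hausdorffMeasure 1 (closure (cell K) ∩ closure (cell L)) = 0 ∨
      ∃ σ, (cell₁ σ = K ∧ cell₂ σ = some L) ∨ (cell₁ σ = L ∧ cell₂ σ = some K)
  center_mem : ∀ K, center K ∈ cell K
  /-- the line through the centers of two neighbouring control volumes is orthogonal to the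
  edge between them -/
  orthogonal : ∀ σ L, cell₂ σ = some L →
    inner ℝ (center L - center (cell₁ σ)) (b σ - a σ) = 0
  /-- the edges that belong to a single control volume lie on the boundary of the domain -/
  boundary_edge : ∀ σ, cell₂ σ = none → segment ℝ (a σ) (b σ) ⊆ frontier Ω
  /-- for a boundary edge, the line through the center of the control volume that is orthogonal
  to the edge meets the edge -/
  boundary_projection : ∀ σ, cell₂ σ = none →
    ∃ y ∈ segment ℝ (a σ) (b σ), inner ℝ (y - center (cell₁ σ)) (b σ - a σ) = 0
  /-- a boundary edge is included in `ΓD` or in `ΓN` -/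
  boundary_split : ∀ σ, cell₂ σ = none →
    openSegment ℝ (a σ) (b σ) ⊆ ΓD ∨ openSegment ℝ (a σ) (b σ) ⊆ ΓN

/-- The hypotheses on the mean value function `r : (0,∞)² → (0,∞)` of the scheme (the values of
`r` outside `(0,∞)²` are irrelevant). -/
structure IsMeanFunction (r : ℝ → ℝ → ℝ) : Prop where
  pos : ∀ x y, 0 < x → 0 < y → 0 < r x y
  mono_left : ∀ x₁ x₂ y, 0 < x₁ → 0 < y → x₁ ≤ x₂ → r x₁ y ≤ r x₂ y
  mono_right : ∀ x y₁ y₂, 0 < x → 0 < y₁ → y₁ ≤ y₂ → r x y₁ ≤ r x y₂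
  diag : ∀ x, 0 < x → r x x = x
  symm : ∀ x y, 0 < x → 0 < y → r x y = r y x
  homogeneous : ∀ c x y, 0 < c → 0 < x → 0 < y → r (c * x) (c * y) = c * r x y
  log_mean_le : ∀ x y, 0 < x → 0 < y → x ≠ y → (x - y) / (Real.log x - Real.log y) ≤ r x y
  le_max : ∀ x y, 0 < x → 0 < y → x ≠ y → r x y ≤ max x y

/-- The function `Φ_p` generating the Tsallis entropy, for `p > 1`. -/
def Phi (p s : ℝ) : ℝ := (s ^ p - p * s) / (p - 1) + 1

namespace AdmissibleMesh

/-- The set `ℰ_K` of the edges of the control volume `K`. -/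
def edgesOf {Ω ΓD ΓN : Set Plane} {T E : Type} [Fintype E] (M : AdmissibleMesh Ω ΓD ΓN T E)
    (K : T) : Finset E :=
  Finset.univ.filter fun σ => M.cell₁ σ = K ∨ M.cell₂ σ = some K

/-- `σ` is a Dirichlet boundary edge. -/
def IsDirichlet {Ω ΓD ΓN : Set Plane} {T E : Type} (M : AdmissibleMesh Ω ΓD ΓN T E)
    (σ : E) : Prop :=
  M.cell₂ σ = none ∧ openSegment ℝ (M.a σ) (M.b σ) ⊆ ΓD

/-- The measure `m_K` of a control volume. -/
def area {Ω ΓD ΓN : Set Plane} {T E : Type} (M : AdmissibleMesh Ω ΓD ΓN T E) (K : T) : ℝ :=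
  (volume : Measure Plane).real (M.cell K)

/-- The center `x_σ` of an edge. -/
def edgeCenter {Ω ΓD ΓN : Set Plane} {T E : Type} (M : AdmissibleMesh Ω ΓD ΓN T E)
    (σ : E) : Plane :=
  midpoint ℝ (M.a σ) (M.b σ)

/-- The distance `d(x_K, σ)` between `x_K` and its orthogonal projection on the line
containing `σ`. -/
def distToEdge {Ω ΓD ΓN : Set Plane} {T E : Type} (M : AdmissibleMesh Ω ΓD ΓN T E)
    (K : T) (σ : E) : ℝ :=
  Metric.infDist (M.center K) (affineSpan ℝ {M.a σ, M.b σ} : Set Plane)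

/-- `d_σ = d(x_K, x_L)` if `σ = K|L`, and `d_σ = d(x_K, σ)` if `σ` is a boundary edge of `K`. -/
def dEdge {Ω ΓD ΓN : Set Plane} {T E : Type} (M : AdmissibleMesh Ω ΓD ΓN T E) (σ : E) : ℝ :=
  match M.cell₂ σ with
  | some L => dist (M.center (M.cell₁ σ)) (M.center L)
  | none => M.distToEdge (M.cell₁ σ) σ

/-- The transmissibility `τ_σ = m_σ / d_σ`, where `m_σ` is the length of `σ`. -/
def trans {Ω ΓD ΓN : Set Plane} {T E : Type} (M : AdmissibleMesh Ω ΓD ΓN T E) (σ : E) : ℝ :=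
  dist (M.a σ) (M.b σ) / M.dEdge σ

/-- The mesh satisfies the regularity constraint with parameter `ζ`. -/
def IsRegular {Ω ΓD ΓN : Set Plane} {T E : Type} [Fintype E] (M : AdmissibleMesh Ω ΓD ΓN T E)
    (ζ : ℝ) : Prop :=
  ∀ K, ∀ σ ∈ M.edgesOf K, ζ * M.dEdge σ ≤ M.distToEdge K σ

/-- The neighbour unknown `u_{K,σ}` of a vector `u = (w, g)` with values `w` in the control volumes
and `g` on the Dirichlet edges (`g` is only used there), for an edge `σ` of `K`. -/
def neighbor {Ω ΓD ΓN : Set Plane} {T E : Type} (M : AdmissibleMesh Ω ΓD ΓN T E)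
    (w : T → ℝ) (g : E → ℝ) (K : T) (σ : E) : ℝ :=
  match M.cell₂ σ with
  | some L => if M.cell₁ σ = K then w L else w (M.cell₁ σ)
  | none => if M.IsDirichlet σ then g σ else w K

/-- The difference operator `D_{K,σ} u = u_{K,σ} - u_K`. -/
def diff {Ω ΓD ΓN : Set Plane} {T E : Type} (M : AdmissibleMesh Ω ΓD ΓN T E)
    (w : T → ℝ) (g : E → ℝ) (K : T) (σ : E) : ℝ :=
  M.neighbor w g K σ - w K

/-- The numerical flux `-τ_σ ū_σ D_{K,σ}(log u + V)` of `u = (w, g)`, with `ū_σ = r(u_K, u_{K,σ})`.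
It vanishes on the no-flux boundary edges. -/
def flux {Ω ΓD ΓN : Set Plane} {T E : Type} (M : AdmissibleMesh Ω ΓD ΓN T E)
    (r : ℝ → ℝ → ℝ) (V : Plane → ℝ) (w : T → ℝ) (g : E → ℝ) (K : T) (σ : E) : ℝ :=
  -(M.trans σ * r (w K) (M.neighbor w g K σ) *
    M.diff (fun L => Real.log (w L) + V (M.center L))
      (fun s => Real.log (g s) + V (M.edgeCenter s)) K σ)

/-- `u = (u_K^n)` is a solution of the nonlinear TPFA scheme with time step `Δt`, potential `V`,
boundary data `uD` and initial data `u₀`.  The positivity of the iterates gives sense to the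
logarithms and to the mean values; the cell averages of `u₀` may vanish. -/
structure IsSolution {Ω ΓD ΓN : Set Plane} {T E : Type} [Fintype E]
    (M : AdmissibleMesh Ω ΓD ΓN T E) (r : ℝ → ℝ → ℝ) (V uD u₀ : Plane → ℝ) (Δt : ℝ)
    (u : ℕ → T → ℝ) : Prop where
  pos : ∀ n K, 0 < u (n + 1) K
  initial : ∀ K, u 0 K = (1 / M.area K) * ∫ x in M.cell K, u₀ x
  step : ∀ n K, M.area K * ((u (n + 1) K - u n K) / Δt) +
    ∑ σ ∈ M.edgesOf K, M.flux r V (u (n + 1)) (fun s => uD (M.edgeCenter s)) K σ = 0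

/-- The discrete thermal equilibrium `u_K^∞ = ρ exp(-V(x_K))`. -/
def equilibrium {Ω ΓD ΓN : Set Plane} {T E : Type} (M : AdmissibleMesh Ω ΓD ΓN T E)
    (ρ : ℝ) (V : Plane → ℝ) (K : T) : ℝ :=
  ρ * Real.exp (-V (M.center K))

/-- The value `u_σ^∞ = ρ exp(-V(x_σ))` of the thermal equilibrium on an edge. -/
def edgeEquilibrium {Ω ΓD ΓN : Set Plane} {T E : Type} (M : AdmissibleMesh Ω ΓD ΓN T E)
    (ρ : ℝ) (V : Plane → ℝ) (σ : E) : ℝ :=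
  ρ * Real.exp (-V (M.edgeCenter σ))

/-- The discrete relative entropy `∑_K m_K u_K^∞ Φ_p(u_K / u_K^∞)` of `w = (u_K)`. -/
def entropy {Ω ΓD ΓN : Set Plane} {T E : Type} [Fintype T] (M : AdmissibleMesh Ω ΓD ΓN T E)
    (ρ : ℝ) (V : Plane → ℝ) (p : ℝ) (w : T → ℝ) : ℝ :=
  ∑ K, M.area K * M.equilibrium ρ V K * Phi p (w K / M.equilibrium ρ V K)

end AdmissibleMesh

/-- The explicit decay rate `κ_p`. -/
def kappa (p ζ C m M : ℝ) : ℝ := 4 * (p - 1) / p * (ζ / C ^ 2) * (m / M) ^ p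

end TPFA

end

/-!
The scheme dissipates the relative entropy: by convexity of `Φ_p`, one time step decreases the
entropy by at least `Δt` times the dissipation `∑_σ τ_σ r D(log u + V) D(Φ_p'(u / u^∞))`
(`AdmissibleMesh.entropy_sub_le`). Homogeneity and monotonicity of `r`, its lower bound by the
logarithmic mean and the Stroock–Varopoulos inequality bound the dissipation from below by a
multiple of `∑_σ τ_σ (D v)²`, where `v = (u / u^∞)^(p/2) - 1` vanishes on the Dirichlet edges
(`IsMeanFunction.dissipation_le`). As `(p - 1) Φ_p(s) ≤ (s^(p/2) - 1)²`, the entropy is bounded by a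
multiple of the squared `L²` norm of `v`. The decay then follows from the discrete Poincaré
inequality `∑_K m_K v_K² ≤ (C² / ζ) ∑_σ τ_σ (D v)²`, in which `C` has to depend on `Ω` and `ΓD` only.

This `L²` inequality is obtained from an `L¹` inequality for `w = v²`, bounding `∑_K m_K w_K` by a
constant times the total variation `∑_σ m_σ |D w|` (`exists_l1_poincare`), Young's inequality and
`∑_{σ ∈ ℰ_K} m_σ d(x_K, σ) ≤ 2 m_K` (`AdmissibleMesh.l2_poincare_of_l1_poincare`).

The `L¹` inequality is proved without extension or trace operators. Along almost every segment in
`Ω`, two values of `w` differ by at most the sum of the jumps on the edges met by the segment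
(`AdmissibleMesh.exists_abs_sub_le_sum_crossed`), and the translates of a segment by `h` that meet
an edge `σ` have their starting points in a parallelogram of area at most `m_σ ‖h‖`. Consequently
the `L¹` bound holds on a small ball from which all points see a fixed segment of `ΓD`
(`HasBound.exists_ball`), and, by averaging over translations, it propagates from a subset of
positive measure to any bounded convex subset of `Ω` (`HasBound.of_convex`). Since `Ω` is connected
and, up to a null set, a finite union of open convex polygons, it holds on `Ω` (`HasBound.of_ball`).
The segment of `ΓD` is an edge of some mesh with a Dirichlet edge. It serves for all other meshes:
their boundary edges overlapping it lie in `ΓD`, because `ΓD ∩ ΓN` has length zero. If there is no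
mesh with a Dirichlet edge, nothing is to be proved.
-/

noncomputable section

namespace TPFA

open Filter Topology Set
open scoped ENNReal NNReal

/-! ### Determinants, areas and half-discs in the plane -/

/-- The determinant `u ∧ v` of two vectors of the plane. -/
def cross (u v : Plane) : ℝ := u 0 * v 1 - u 1 * v 0

lemma cross_add_right (u v w : Plane) : cross u (v + w) = cross u v + cross u w := by
  simp [cross]; ring

lemma cross_sub_right (u v w : Plane) : cross u (v - w) = cross u v - cross u w := by
  simp [cross]; ring

lemma cross_smul_right (t : ℝ) (u v : Plane) : cross u (t • v) = t * cross u v := by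
  simp [cross]; ring

lemma cross_self (u : Plane) : cross u u = 0 := by
  simp [cross]; ring

lemma continuous_cross_right (u : Plane) : Continuous (cross u) := by
  unfold cross; fun_prop

lemma continuous_cross_left (u : Plane) : Continuous (fun v => cross v u) := by
  unfold cross; fun_prop

/-- Cramer's rule in the plane. -/
lemma eq_add_smul_of_cross_ne_zero {u k : Plane} (hk : cross u k ≠ 0) (h : Plane) :
    h = (cross h k / cross u k) • u + (cross u h / cross u k) • k := by
  ext i
  have : cross u k • h i = cross h k * u i + cross u h * k i := by
    fin_cases i <;> simp [cross] <;> ring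
  simp only [PiLp.add_apply, PiLp.smul_apply, smul_eq_mul] at this ⊢
  field_simp
  linarith

lemma sq_cross (u v : Plane) : cross u v ^ 2 = ‖u‖ ^ 2 * ‖v‖ ^ 2 - inner ℝ u v ^ 2 := by
  simp only [EuclideanSpace.norm_sq_eq, Fin.sum_univ_two, Real.norm_eq_abs, sq_abs, cross,
    PiLp.inner_apply, RCLike.inner_apply, conj_trivial]
  ring

lemma abs_cross_le (u v : Plane) : |cross u v| ≤ ‖u‖ * ‖v‖ := by
  refine abs_le_of_sq_le_sq ?_ (by positivity)
  rw [sq_cross, mul_pow]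
  nlinarith [sq_nonneg (inner ℝ u v)]

lemma volume_parallelepiped (u v : Plane) :
    volume (parallelepiped ![u, v]) = ENNReal.ofReal |cross u v| := by
  have : Fact (Module.finrank ℝ Plane = 2) := ⟨by simp⟩
  let o : Orientation ℝ Plane (Fin 2) :=
    (EuclideanSpace.basisFun (Fin 2) ℝ).toBasis.orientation
  rw [← o.measure_eq_volume, AlternatingMap.measure_parallelepiped, ← o.areaForm_to_volumeForm]
  congr 1
  rw [← sq_eq_sq₀ (abs_nonneg _) (abs_nonneg _), sq_abs, sq_abs, sq_cross,
    ← o.inner_sq_add_areaForm_sq]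
  ring

lemma volume_segment (a b : Plane) : volume (segment ℝ a b) = 0 := by
  refine measure_mono_null (t := (fun x => a + x) '' parallelepiped ![b - a, b - a]) ?_ ?_
  · rw [segment_eq_image']
    rintro _ ⟨t, ht, rfl⟩
    refine ⟨t • (b - a), (mem_parallelepiped_iff _ _).2 ⟨![t, 0], ?_, by simp⟩, rfl⟩
    constructor <;> intro i <;> fin_cases i <;> simp [ht.1, ht.2]
  · rw [image_add_left, measure_preimage_add, volume_parallelepiped, cross_self]
    simp

/-- The set of points from which a move along `h` meets the segment `[a, b]` is contained in a
parallelogram. -/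
lemma volume_shadow_le (a b h : Plane) :
    volume {x : Plane | (segment ℝ x (x + h) ∩ segment ℝ a b).Nonempty} ≤
      ENNReal.ofReal (dist a b * ‖h‖) := by
  calc _ ≤ volume ((fun x => a + x) '' parallelepiped ![b - a, -h]) := by
        refine measure_mono ?_
        rintro x ⟨z, hz, hz'⟩
        rw [segment_eq_image'] at hz hz'
        obtain ⟨t, ht, rfl⟩ := hz
        obtain ⟨s, hs, hst⟩ := hz'
        refine ⟨x - a, (mem_parallelepiped_iff _ _).2 ⟨![s, t], ?_, ?_⟩, by simp⟩
        · constructor <;> intro i <;> fin_cases i <;> simp [ht.1, ht.2, hs.1, hs.2]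
        · simp only [add_sub_cancel_left] at hst
          simp only [Fin.sum_univ_two, Matrix.cons_val_zero, Matrix.cons_val_one, smul_neg]
          rw [← sub_eq_add_neg, eq_sub_iff_add_eq, sub_add_eq_add_sub, ← hst, add_sub_cancel_left]
    _ = ENNReal.ofReal |cross (b - a) (-h)| := by
        rw [image_add_left, measure_preimage_add, volume_parallelepiped]
    _ ≤ _ := by
        refine ENNReal.ofReal_le_ofReal ((abs_cross_le _ _).trans_eq ?_)
        rw [norm_neg, dist_comm, dist_eq_norm]

/-- A parallelogram is covered by two congruent triangles. -/
lemma abs_cross_le_two_mul_volume (a b c : Plane) :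
    |cross (b - a) (c - a)| ≤ 2 * (volume : Measure Plane).real (convexHull ℝ {c, a, b}) := by
  set S : Set Plane := convexHull ℝ {c, a, b}
  have hS : volume S ≠ ⊤ :=
    ((Set.toFinite ({c, a, b} : Set Plane)).isCompact_convexHull ℝ).measure_lt_top.ne
  have hsub : (fun x => c + x) '' parallelepiped ![a - c, b - c] ⊆
      S ∪ (fun x => (a + b) - x) '' S := by
    rintro _ ⟨_, hx, rfl⟩
    obtain ⟨t, ht, rfl⟩ := (mem_parallelepiped_iff _ _).1 hx
    have h0 := ht.1 0
    have h1 := ht.1 1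
    have h0' := ht.2 0
    have h1' := ht.2 1
    simp only [Pi.zero_apply, Pi.one_apply] at h0 h1 h0' h1'
    have key : ∀ α β : ℝ, 0 ≤ α → 0 ≤ β → α + β ≤ 1 →
        c + (α • (a - c) + β • (b - c)) ∈ S := by
      intro α β hα hβ hαβ
      have hc : Convex ℝ S := convex_convexHull ℝ _
      have hmem : ∀ x ∈ ({c, a, b} : Set Plane), x ∈ S := fun x hx => subset_convexHull ℝ _ hx
      have := hc.sum_mem (t := Finset.univ) (w := ![1 - α - β, α, β]) (z := ![c, a, b])
        (by intro i _; fin_cases i <;> simp <;> linarith)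
        (by simp only [Fin.sum_univ_three, Matrix.cons_val]; ring)
        (by intro i _; fin_cases i <;> exact hmem _ (by simp))
      convert this using 1
      simp [Fin.sum_univ_three]
      module
    simp only [Fin.sum_univ_two, Matrix.cons_val_zero, Matrix.cons_val_one]
    by_cases hle : t 0 + t 1 ≤ 1
    · exact Or.inl (key _ _ h0 h1 hle)
    · refine Or.inr ⟨_, key (1 - t 0) (1 - t 1) (by linarith) (by linarith) (by linarith), ?_⟩
      module
  have himg : volume ((fun x => (a + b) - x) '' S) = volume S := by
    have : (fun x : Plane => (a + b) - x) '' S = (fun x => (a + b) - x) ⁻¹' S :=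
      congrFun (Set.image_eq_preimage_of_inverse (fun x => by simp) (fun x => by simp)) S
    rw [this]
    exact (Measure.measurePreserving_sub_left volume (a + b)).measure_preimage_emb
      (MeasurableEquiv.subLeft (a + b)).measurableEmbedding S
  have h1 : volume (parallelepiped ![a - c, b - c]) ≤ 2 * volume S := by
    calc _ = volume ((fun x => c + x) '' parallelepiped ![a - c, b - c]) := by
          rw [image_add_left, measure_preimage_add]
      _ ≤ _ := measure_mono hsub
      _ ≤ volume S + volume ((fun x => (a + b) - x) '' S) := measure_union_le _ _
      _ = _ := by rw [himg, two_mul]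
  rw [volume_parallelepiped] at h1
  have h2 := ENNReal.toReal_mono (ENNReal.mul_ne_top (by simp) hS) h1
  rw [ENNReal.toReal_ofReal (abs_nonneg _), ENNReal.toReal_mul] at h2
  have h3 : cross (a - c) (b - c) = cross (b - a) (c - a) := by simp [cross]; ring
  rw [h3] at h2
  simpa [Measure.real] using h2

lemma dist_mul_infDist_le_abs_cross {a b : Plane} (hab : a ≠ b) (c : Plane) :
    dist a b * Metric.infDist c (affineSpan ℝ {a, b} : Set Plane) ≤
      |cross (b - a) (c - a)| := by
  have hn : ‖b - a‖ ≠ 0 := by simpa [sub_eq_zero] using hab.symm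
  set t : ℝ := inner ℝ (b - a) (c - a) / ‖b - a‖ ^ 2
  have hy : AffineMap.lineMap a b t ∈ (affineSpan ℝ {a, b} : Set Plane) :=
    AffineMap.lineMap_mem_affineSpan_pair t a b
  have hy' : (AffineMap.lineMap a b t : Plane) = a + t • (b - a) := by
    rw [AffineMap.lineMap_apply, vsub_eq_sub, vadd_eq_add, add_comm]
  set y : Plane := AffineMap.lineMap a b t
  have horth : inner ℝ (b - a) (c - y) = 0 := by
    have : c - y = (c - a) - t • (b - a) := by rw [hy']; abel
    rw [this, inner_sub_right, inner_smul_right, real_inner_self_eq_norm_sq]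
    simp only [t]
    field_simp
    ring
  have hcr : cross (b - a) (c - a) = cross (b - a) (c - y) := by
    have : c - a = (c - y) + t • (b - a) := by rw [hy']; abel
    rw [this, cross_add_right, cross_smul_right, cross_self]; ring
  have hsq : |cross (b - a) (c - y)| = ‖b - a‖ * ‖c - y‖ := by
    rw [← sq_eq_sq₀ (abs_nonneg _) (by positivity), sq_abs, sq_cross, horth]; ring
  rw [hcr, hsq, dist_comm, dist_eq_norm]
  gcongr
  exact (Metric.infDist_le_dist_of_mem hy).trans_eq (dist_eq_norm _ _)

/-- Near a point `z` of the open segment `]a, b[`, where `a` and `b` belong to the closure of an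
open convex set `C`, the set `C` contains the half-disc on its side of the line `ab`. -/
lemma eventually_mem_of_cross_pos {C : Set Plane} (hC : Convex ℝ C) (hCo : IsOpen C)
    {a b c z : Plane} (ha : a ∈ closure C) (hb : b ∈ closure C) (hc : c ∈ C)
    (hz : z ∈ openSegment ℝ a b) :
    ∀ᶠ y in 𝓝 z, 0 < cross (b - a) (y - z) * cross (b - a) (c - z) → y ∈ C := by
  by_cases hk : cross (b - a) (c - z) = 0
  · simp [hk]
  rw [openSegment_eq_image'] at hz
  obtain ⟨s, hs, rfl⟩ := hz
  set z : Plane := a + s • (b - a)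
  set α : Plane → ℝ := fun y => cross (y - z) (c - z) / cross (b - a) (c - z)
  set β : Plane → ℝ := fun y => cross (b - a) (y - z) / cross (b - a) (c - z)
  have hα : Continuous α := by
    have := continuous_cross_left (c - z)
    exact (this.comp (continuous_id.sub continuous_const)).div_const _
  have hβ : Continuous β := by
    have := continuous_cross_right (b - a)
    exact (this.comp (continuous_id.sub continuous_const)).div_const _
  have hα0 : α z = 0 := by simp [α, cross]
  have hβ0 : β z = 0 := by simp [β, cross]
  have h1 : ∀ᶠ y in 𝓝 z, β y < 1 :=
    hβ.continuousAt.eventually_lt continuousAt_const (by rw [hβ0]; norm_num)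
  have hcont : ContinuousAt (fun y => s + α y / (1 - β y)) z :=
    continuousAt_const.add (hα.continuousAt.div (continuousAt_const.sub hβ.continuousAt)
      (by rw [hβ0]; norm_num))
  have h2 : ∀ᶠ y in 𝓝 z, s + α y / (1 - β y) ∈ Ioo (0 : ℝ) 1 := by
    refine hcont.eventually_mem (Ioo_mem_nhds ?_ ?_) <;> simp [hα0, hs.1, hs.2]
  filter_upwards [h1, h2] with y hy1 hy2 hy
  have hβpos : 0 < β y := by
    have : β y = (cross (b - a) (y - z) * cross (b - a) (c - z)) / cross (b - a) (c - z) ^ 2 := by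
      simp only [β]; field_simp
    rw [this]; positivity
  have hq : a + (s + α y / (1 - β y)) • (b - a) ∈ closure C := by
    refine hC.closure.segment_subset ha hb ?_
    rw [segment_eq_image']
    exact ⟨_, ⟨hy2.1.le, hy2.2.le⟩, rfl⟩
  have hcomb := hC.combo_interior_closure_mem_interior (x := c) (by rwa [hCo.interior_eq]) hq
    (a := β y) (b := 1 - β y) hβpos (by linarith) (by ring)
  rw [hCo.interior_eq] at hcomb
  convert hcomb using 1
  have hdec : y = z + (α y • (b - a) + β y • (c - z)) := by
    have := eq_add_smul_of_cross_ne_zero hk (y - z)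
    rw [← sub_eq_iff_eq_add']; exact this
  have h1' : 1 - β y ≠ 0 := by linarith
  have hs1 : (1 - β y) • (s + α y / (1 - β y)) • (b - a) =
      ((1 - β y) * s) • (b - a) + α y • (b - a) := by
    rw [smul_smul, ← add_smul]; congr 1; field_simp
  rw [smul_add, hs1]
  nth_rewrite 1 [hdec]
  simp only [z]
  module

/-- Near a point of the open segment `]a, b[`, the points of the line `ab` belong to the open
segment. -/
lemma eventually_mem_openSegment_of_cross_eq_zero {a b z : Plane} (hab : a ≠ b)
    (hz : z ∈ openSegment ℝ a b) :
    ∀ᶠ y in 𝓝 z, cross (b - a) (y - z) = 0 → y ∈ openSegment ℝ a b := by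
  have hn : ‖b - a‖ ≠ 0 := by simpa [sub_eq_zero] using hab.symm
  rw [openSegment_eq_image'] at hz ⊢
  obtain ⟨s, hs, rfl⟩ := hz
  set z : Plane := a + s • (b - a)
  have hcont : Continuous fun y : Plane => s + inner ℝ (b - a) (y - z) / ‖b - a‖ ^ 2 := by
    fun_prop
  have h2 : ∀ᶠ y in 𝓝 z, s + inner ℝ (b - a) (y - z) / ‖b - a‖ ^ 2 ∈ Ioo (0 : ℝ) 1 := by
    refine hcont.continuousAt.eventually_mem (Ioo_mem_nhds ?_ ?_) <;> simp [hs.1, hs.2]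
  filter_upwards [h2] with y hy h0
  refine ⟨_, hy, ?_⟩
  have : y - z = (inner ℝ (b - a) (y - z) / ‖b - a‖ ^ 2) • (b - a) := by
    rw [← sub_eq_zero, ← norm_eq_zero, ← sq_eq_zero_iff, @norm_sub_sq_real, norm_smul,
      inner_smul_right, mul_pow, Real.norm_eq_abs, sq_abs,
      real_inner_comm]
    have h1 := sq_cross (b - a) (y - z)
    rw [h0, real_inner_comm] at h1
    field_simp
    linarith
  simp only [add_smul]
  rw [← add_assoc, ← this]
  simp [z]

/-- An open convex set does not meet the line that carries a segment of its boundary. -/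
lemma cross_ne_zero_of_segment_subset_frontier {C : Set Plane} (hC : Convex ℝ C) (hCo : IsOpen C)
    {a b c z : Plane} (hab : a ≠ b) (hseg : segment ℝ a b ⊆ frontier C) (hc : c ∈ C)
    (hz : z ∈ openSegment ℝ a b) : cross (b - a) (c - z) ≠ 0 := by
  intro h0
  have h1 := eventually_mem_openSegment_of_cross_eq_zero hab hz
  have hcont : ContinuousAt (fun t : ℝ => z + t • (c - z)) 0 := by fun_prop
  have hev : ∀ᶠ t in 𝓝[>] (0 : ℝ), z + t • (c - z) ∈ openSegment ℝ a b := by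
    have h2 : Tendsto (fun t : ℝ => z + t • (c - z)) (𝓝 0) (𝓝 z) := by
      simpa [ContinuousAt] using hcont
    filter_upwards [(h2.eventually h1).filter_mono nhdsWithin_le_nhds] with t ht
    refine ht ?_
    rw [add_sub_cancel_left, cross_smul_right, h0, mul_zero]
  have hlt : ∀ᶠ t in 𝓝[>] (0 : ℝ), t ∈ Ioo (0 : ℝ) 1 := Ioo_mem_nhdsGT one_pos
  obtain ⟨t, ht, ht1⟩ := (hev.and hlt).exists
  have hzc : z ∈ closure C :=
    frontier_subset_closure (hseg (openSegment_subset_segment _ _ _ hz))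
  have hmem := hC.combo_interior_closure_mem_interior (x := c) (by rwa [hCo.interior_eq]) hzc
    (a := t) (b := 1 - t) ht1.1 (by linarith [ht1.2]) (by ring)
  have hf := hseg (openSegment_subset_segment _ _ _ ht)
  apply hf.2
  convert hmem using 1
  module

/-! ### Polygonal domains and segments crossing a mesh -/

lemma IsPolygonalDomain.isOpen {Ω : Set Plane} (h : IsPolygonalDomain Ω) : IsOpen Ω := by
  obtain ⟨-, S, rfl⟩ := h
  exact isOpen_interior

lemma isClosed_biUnion_convexHull (S : Finset (Finset Plane)) :
    IsClosed (⋃ s ∈ S, convexHull ℝ (s : Set Plane)) :=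
  isClosed_biUnion_finset fun s _ => (s.finite_toSet.isCompact_convexHull ℝ).isClosed

/-- A polygonal domain has no slits. -/
lemma IsPolygonalDomain.interior_closure {Ω : Set Plane} (h : IsPolygonalDomain Ω) :
    interior (closure Ω) = Ω := by
  refine Subset.antisymm ?_ (h.isOpen.subset_interior_closure)
  obtain ⟨-, S, rfl⟩ := h
  exact interior_mono (closure_minimal interior_subset (isClosed_biUnion_convexHull S))

lemma IsPolygonalDomain.isCompact_closure {Ω : Set Plane} (h : IsPolygonalDomain Ω) :
    IsCompact (closure Ω) := by
  obtain ⟨-, S, rfl⟩ := h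
  have : IsCompact (⋃ s ∈ S, convexHull ℝ (s : Set Plane)) :=
    S.isCompact_biUnion fun s _ => s.finite_toSet.isCompact_convexHull ℝ
  exact this.of_isClosed_subset isClosed_closure (closure_minimal interior_subset this.isClosed)

/-- The last point of `closure C` on a segment that starts in the open set `C`. -/
lemma exists_exit_point {C : Set Plane} (hCo : IsOpen C) {x y : Plane} (hx : x ∈ C)
    (hy : y ∉ closure C) :
    ∃ t ∈ Ioo (0 : ℝ) 1, x + t • (y - x) ∈ frontier C ∧
      ∀ s ∈ Ioc t 1, x + s • (y - x) ∉ closure C := by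
  have hcont : Continuous fun t : ℝ => x + t • (y - x) := by fun_prop
  have hcomp : IsCompact (Icc (0 : ℝ) 1 ∩ (fun t : ℝ => x + t • (y - x)) ⁻¹' closure C) :=
    isCompact_Icc.inter_right (isClosed_closure.preimage hcont)
  obtain ⟨t, ⟨⟨ht0, ht1⟩, htC⟩, hmax⟩ := hcomp.exists_isGreatest
    ⟨0, by simp, by simpa using subset_closure hx⟩
  have ht1' : t < 1 := by
    refine lt_of_le_of_ne ht1 ?_
    rintro rfl
    exact hy (by simpa using htC)
  have hnot : ∀ s ∈ Ioc t 1, x + s • (y - x) ∉ closure C := by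
    intro s hs hsC
    exact absurd (hmax ⟨⟨ht0.trans hs.1.le, hs.2⟩, hsC⟩) (not_le.2 hs.1)
  have hzC : x + t • (y - x) ∉ C := by
    intro hz
    have h1 : ∀ᶠ s in 𝓝[>] t, x + s • (y - x) ∈ C :=
      (hcont.continuousAt.eventually_mem (hCo.mem_nhds hz)).filter_mono nhdsWithin_le_nhds
    obtain ⟨s, hs, hst⟩ := (h1.and (Ioc_mem_nhdsGT ht1')).exists
    exact hnot s hst (subset_closure hs)
  refine ⟨t, ⟨lt_of_le_of_ne ht0 ?_, ht1'⟩, ⟨htC, by rwa [hCo.interior_eq]⟩, hnot⟩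
  rintro rfl
  exact hzC (by simpa using hx)

namespace AdmissibleMesh

variable {Ω ΓD ΓN : Set Plane} {T E : Type} (M : AdmissibleMesh Ω ΓD ΓN T E)

lemma isOpen_cell (K : T) : IsOpen (M.cell K) := by
  obtain ⟨s, hs⟩ := M.cell_polygon K
  rw [hs]; exact isOpen_interior

lemma convex_cell (K : T) : Convex ℝ (M.cell K) := by
  obtain ⟨s, hs⟩ := M.cell_polygon K
  rw [hs]; exact (convex_convexHull ℝ _).interior

lemma isBounded_cell (K : T) : Bornology.IsBounded (M.cell K) := by
  obtain ⟨s, hs⟩ := M.cell_polygon K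
  rw [hs]
  exact (s.finite_toSet.isCompact_convexHull ℝ).isBounded.subset interior_subset

/-- `σ` is an edge of `K`. -/
def IsEdgeOf (σ : E) (K : T) : Prop := M.cell₁ σ = K ∨ M.cell₂ σ = some K

lemma edge_subset_frontier {σ : E} {K : T} (h : M.IsEdgeOf σ K) :
    segment ℝ (M.a σ) (M.b σ) ⊆ frontier (M.cell K) := by
  rw [M.frontier_cell K]
  exact subset_biUnion_of_mem (u := fun σ => segment ℝ (M.a σ) (M.b σ)) h

lemma exists_edge_of_mem_frontier {K : T} {z : Plane} (hz : z ∈ frontier (M.cell K)) :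
    ∃ σ, M.IsEdgeOf σ K ∧ z ∈ segment ℝ (M.a σ) (M.b σ) := by
  rw [M.frontier_cell K] at hz
  simpa [IsEdgeOf] using hz

lemma a_mem_closure {σ : E} {K : T} (h : M.IsEdgeOf σ K) : M.a σ ∈ closure (M.cell K) :=
  frontier_subset_closure (M.edge_subset_frontier h (left_mem_segment _ _ _))

lemma b_mem_closure {σ : E} {K : T} (h : M.IsEdgeOf σ K) : M.b σ ∈ closure (M.cell K) :=
  frontier_subset_closure (M.edge_subset_frontier h (right_mem_segment _ _ _))

lemma cross_center_ne_zero {σ : E} {K : T} (h : M.IsEdgeOf σ K) {z : Plane}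
    (hz : z ∈ openSegment ℝ (M.a σ) (M.b σ)) :
    cross (M.b σ - M.a σ) (M.center K - z) ≠ 0 :=
  cross_ne_zero_of_segment_subset_frontier (M.convex_cell K) (M.isOpen_cell K) (M.a_ne_b σ)
    (M.edge_subset_frontier h) (M.center_mem K) hz

/-- Two control volumes with a common edge lie on opposite sides of it. -/
lemma cross_center_mul_neg {σ : E} {K L : T} (hK : M.IsEdgeOf σ K) (hL : M.IsEdgeOf σ L)
    (hKL : K ≠ L) {z : Plane} (hz : z ∈ openSegment ℝ (M.a σ) (M.b σ)) :
    cross (M.b σ - M.a σ) (M.center K - z) * cross (M.b σ - M.a σ) (M.center L - z) < 0 := by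
  by_contra hneg
  have hKne := M.cross_center_ne_zero hK hz
  have hLne := M.cross_center_ne_zero hL hz
  have hpos := lt_of_le_of_ne (not_lt.1 hneg) (mul_ne_zero hKne hLne).symm
  have h1 := eventually_mem_of_cross_pos (M.convex_cell K) (M.isOpen_cell K)
    (M.a_mem_closure hK) (M.b_mem_closure hK) (M.center_mem K) hz
  have h2 := eventually_mem_of_cross_pos (M.convex_cell L) (M.isOpen_cell L)
    (M.a_mem_closure hL) (M.b_mem_closure hL) (M.center_mem L) hz
  have htend : Tendsto (fun t : ℝ => z + t • (M.center K - z)) (𝓝[>] 0) (𝓝 z) := by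
    have : ContinuousAt (fun t : ℝ => z + t • (M.center K - z)) 0 := by fun_prop
    simpa [ContinuousAt] using this.mono_left nhdsWithin_le_nhds
  obtain ⟨t, ht, ht0⟩ := ((htend.eventually (h1.and h2)).and self_mem_nhdsWithin).exists
  have ht0 : 0 < t := ht0
  simp only [add_sub_cancel_left, cross_smul_right] at ht
  refine (M.cell_disjoint K L hKL).ne_of_mem (ht.1 ?_) (ht.2 ?_) rfl
  · rw [mul_assoc]; exact mul_pos ht0 (mul_self_pos.2 hKne)
  · rw [mul_assoc]; exact mul_pos ht0 hpos

/-- Two control volumes together with their common edge fill a neighbourhood of any point in the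
relative interior of this edge. -/
lemma eventually_mem_of_edge {σ : E} {K L : T} (hK : M.IsEdgeOf σ K) (hL : M.IsEdgeOf σ L)
    (hKL : K ≠ L) {z : Plane} (hz : z ∈ openSegment ℝ (M.a σ) (M.b σ)) :
    ∀ᶠ y in 𝓝 z, y ∈ M.cell K ∨ y ∈ M.cell L ∨ y ∈ openSegment ℝ (M.a σ) (M.b σ) := by
  have hneg := M.cross_center_mul_neg hK hL hKL hz
  filter_upwards [eventually_mem_of_cross_pos (M.convex_cell K) (M.isOpen_cell K)
    (M.a_mem_closure hK) (M.b_mem_closure hK) (M.center_mem K) hz,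
    eventually_mem_of_cross_pos (M.convex_cell L) (M.isOpen_cell L)
    (M.a_mem_closure hL) (M.b_mem_closure hL) (M.center_mem L) hz,
    eventually_mem_openSegment_of_cross_eq_zero (M.a_ne_b σ) hz] with y h1 h2 h3
  rcases mul_neg_iff.1 hneg with ⟨hk, hl⟩ | ⟨hk, hl⟩ <;>
  rcases lt_trichotomy (cross (M.b σ - M.a σ) (y - z)) 0 with h | h | h
  · exact Or.inr (Or.inl (h2 (mul_pos_of_neg_of_neg h hl)))
  · exact Or.inr (Or.inr (h3 h))
  · exact Or.inl (h1 (mul_pos h hk))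
  · exact Or.inl (h1 (mul_pos_of_neg_of_neg h hk))
  · exact Or.inr (Or.inr (h3 h))
  · exact Or.inr (Or.inl (h2 (mul_pos h hl)))

lemma openSegment_subset_domain (hΩ : IsPolygonalDomain Ω) {σ : E} {L : T}
    (hσ : M.cell₂ σ = some L) : openSegment ℝ (M.a σ) (M.b σ) ⊆ Ω := by
  intro z hz
  have hne : M.cell₁ σ ≠ L := fun h => M.cell₂_ne σ (by rw [hσ, h])
  rw [← hΩ.interior_closure, mem_interior_iff_mem_nhds]
  filter_upwards [M.eventually_mem_of_edge (σ := σ) (Or.inl rfl) (Or.inr hσ) hne hz] with y hy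
  rcases hy with h | h | h
  · exact subset_closure (M.cell_subset _ h)
  · exact subset_closure (M.cell_subset _ h)
  · exact closure_mono (M.cell_subset _) (frontier_subset_closure
      (M.edge_subset_frontier (Or.inl rfl) (openSegment_subset_segment _ _ _ h)))

/-- The jump of `w` across an edge, with the value `0` outside of a Dirichlet edge and no jump
across the other boundary edges. -/
def jump (w : T → ℝ) (σ : E) : ℝ := M.diff w (fun _ => 0) (M.cell₁ σ) σ

lemma jump_of_some (w : T → ℝ) {σ : E} {L : T} (h : M.cell₂ σ = some L) :
    M.jump w σ = w L - w (M.cell₁ σ) := by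
  simp [jump, diff, neighbor, h]

lemma jump_of_isDirichlet (w : T → ℝ) {σ : E} (h : M.IsDirichlet σ) :
    M.jump w σ = -w (M.cell₁ σ) := by
  simp [jump, diff, neighbor, h, h.1]

lemma jump_of_not_isDirichlet (w : T → ℝ) {σ : E} (h : M.cell₂ σ = none)
    (hD : ¬ M.IsDirichlet σ) : M.jump w σ = 0 := by
  simp [jump, diff, neighbor, h, hD]

lemma exists_neighbor {σ : E} {K : T} (h : M.IsEdgeOf σ K) (hσ : M.cell₂ σ ≠ none) (w : T → ℝ) :
    ∃ L, M.IsEdgeOf σ L ∧ K ≠ L ∧ |M.jump w σ| = |w K - w L| := by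
  obtain ⟨L, hL⟩ := Option.ne_none_iff_exists'.1 hσ
  have hne : M.cell₁ σ ≠ L := fun h => M.cell₂_ne σ (by rw [hL, h])
  rw [M.jump_of_some w hL]
  rcases h with h | h
  · exact ⟨L, Or.inr hL, h ▸ hne, by rw [h, abs_sub_comm]⟩
  · obtain rfl : L = K := by simpa [hL] using h
    exact ⟨M.cell₁ σ, Or.inl rfl, hne.symm, rfl⟩

/-- The edges that meet the segment `[x, y]`. -/
def crossed [Fintype E] (x y : Plane) : Finset E :=
  Finset.univ.filter fun σ => (segment ℝ x y ∩ segment ℝ (M.a σ) (M.b σ)).Nonempty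

lemma mem_crossed [Fintype E] {x y : Plane} {σ : E} :
    σ ∈ M.crossed x y ↔ (segment ℝ x y ∩ segment ℝ (M.a σ) (M.b σ)).Nonempty := by
  simp [crossed]

lemma segment_add_smul_subset {x y : Plane} {s : ℝ} (hs : s ∈ Icc (0 : ℝ) 1) {z : Plane}
    (hz : z ∈ segment ℝ (x + s • (y - x)) y) : ∃ r ∈ Icc s 1, z = x + r • (y - x) := by
  rw [segment_eq_image'] at hz
  obtain ⟨t, ht, rfl⟩ := hz
  refine ⟨s + t * (1 - s), ⟨?_, ?_⟩, by module⟩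
  · nlinarith [ht.1, hs.2]
  · nlinarith [ht.2, hs.2]

/-- Along a segment that avoids the vertices of the mesh and stays in `Ω` (except possibly at its
end), the total variation of the piecewise constant function `w` is at most the sum of its jumps
on the edges that meet the segment. -/
lemma exists_abs_sub_le_sum_crossed [Fintype E] (hΩ : IsOpen Ω) (w : T → ℝ) {x y : Plane} {K : T}
    (hx : x ∈ M.cell K) (hxy : ∀ t ∈ Ico (0 : ℝ) 1, x + t • (y - x) ∈ Ω)
    (hvert : ∀ σ, M.a σ ∉ segment ℝ x y ∧ M.b σ ∉ segment ℝ x y) :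
    ∃ L, y ∈ closure (M.cell L) ∧ |w K - w L| ≤ ∑ σ ∈ M.crossed x y, |M.jump w σ| := by
  induction hn : (M.crossed x y).card using Nat.strong_induction_on generalizing x K with
  | _ n ih =>
  by_cases hy : y ∈ closure (M.cell K)
  · exact ⟨K, hy, by simpa using Finset.sum_nonneg fun σ _ => abs_nonneg (M.jump w σ)⟩
  obtain ⟨t, ht, hz, hafter⟩ := exists_exit_point (M.isOpen_cell K) hx hy
  set z := x + t • (y - x) with hzdef
  obtain ⟨σ, hσK, hzσ⟩ := M.exists_edge_of_mem_frontier hz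
  have hzxy : z ∈ segment ℝ x y := by
    rw [segment_eq_image']; exact ⟨t, ⟨ht.1.le, ht.2.le⟩, rfl⟩
  have hzo : z ∈ openSegment ℝ (M.a σ) (M.b σ) := by
    refine mem_openSegment_of_ne_left_right ?_ ?_ hzσ
    · intro h; exact (hvert σ).1 (h ▸ hzxy)
    · intro h; exact (hvert σ).2 (h ▸ hzxy)
  have hint : M.cell₂ σ ≠ none := by
    intro h
    have h1 := M.boundary_edge σ h hzσ
    rw [frontier, hΩ.interior_eq] at h1
    exact h1.2 (hxy t ⟨ht.1.le, ht.2⟩)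
  obtain ⟨L, hσL, hKL, hjump⟩ := M.exists_neighbor hσK hint w
  have htend : Tendsto (fun s : ℝ => x + s • (y - x)) (𝓝[>] t) (𝓝 z) := by
    have : ContinuousAt (fun s : ℝ => x + s • (y - x)) t := by fun_prop
    exact this.mono_left nhdsWithin_le_nhds
  obtain ⟨s, hs, hst⟩ := ((htend.eventually (M.eventually_mem_of_edge hσK hσL hKL hzo)).and
    (Ioo_mem_nhdsGT ht.2)).exists
  have hsK := hafter s ⟨hst.1, hst.2.le⟩
  have hsL : x + s • (y - x) ∈ M.cell L := by
    rcases hs with h | h | h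
    · exact absurd (subset_closure h) hsK
    · exact h
    · exact absurd (frontier_subset_closure
        (M.edge_subset_frontier hσK (openSegment_subset_segment _ _ _ h))) hsK
  have hs01 : s ∈ Icc (0 : ℝ) 1 := ⟨ht.1.le.trans hst.1.le, hst.2.le⟩
  have hsub : segment ℝ (x + s • (y - x)) y ⊆ segment ℝ x y := by
    intro p hp
    obtain ⟨r, hr, rfl⟩ := segment_add_smul_subset hs01 hp
    rw [segment_eq_image']
    exact ⟨r, ⟨hs01.1.trans hr.1, hr.2⟩, rfl⟩
  have hσmem : σ ∈ M.crossed x y := M.mem_crossed.2 ⟨z, hzxy, hzσ⟩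
  have hcross : M.crossed (x + s • (y - x)) y ⊆ (M.crossed x y).erase σ := by
    intro τ hτ
    obtain ⟨p, hp, hpτ⟩ := M.mem_crossed.1 hτ
    refine Finset.mem_erase.2 ⟨?_, M.mem_crossed.2 ⟨p, hsub hp, hpτ⟩⟩
    rintro rfl
    obtain ⟨r, hr, rfl⟩ := segment_add_smul_subset hs01 hp
    exact hafter r ⟨hst.1.trans_le hr.1, hr.2⟩
      (frontier_subset_closure (M.edge_subset_frontier hσK hpτ))
  have hcard : (M.crossed (x + s • (y - x)) y).card < n := by
    rw [← hn]
    exact (Finset.card_le_card hcross).trans_lt (Finset.card_erase_lt_of_mem hσmem)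
  obtain ⟨L', hyL', hle⟩ := ih _ hcard hsL (fun r hr => by
      have := hxy (s + r * (1 - s)) ⟨by nlinarith [hr.1, hs01.1, hs01.2],
        by nlinarith [hr.2, hst.2]⟩
      convert this using 1
      module) (fun τ => ⟨fun h => (hvert τ).1 (hsub h), fun h => (hvert τ).2 (hsub h)⟩) rfl
  refine ⟨L', hyL', ?_⟩
  calc |w K - w L'| ≤ |w K - w L| + |w L - w L'| := abs_sub_le _ _ _
    _ ≤ |M.jump w σ| + ∑ τ ∈ (M.crossed x y).erase σ, |M.jump w τ| := by
        rw [hjump]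
        gcongr
        exact hle.trans (Finset.sum_le_sum_of_subset_of_nonneg hcross
          fun _ _ _ => abs_nonneg _)
    _ = _ := Finset.add_sum_erase _ (fun τ => |M.jump w τ|) hσmem

end AdmissibleMesh

/-! ### Propagation of the bound by the total variation -/

namespace AdmissibleMesh

variable {Ω ΓD ΓN : Set Plane} {T E : Type} (M : AdmissibleMesh Ω ΓD ΓN T E)

/-- The piecewise constant function with values `w K` in the control volumes (and `0` outside of
their union). -/
def cellFun [Fintype T] (w : T → ℝ) (x : Plane) : ℝ≥0∞ :=
  ∑ K, (M.cell K).indicator (fun _ => ENNReal.ofReal (w K)) x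

/-- The total variation of a piecewise constant function, including the jump to the value `0` on
the Dirichlet edges. -/
def totalVar [Fintype E] (w : T → ℝ) : ℝ≥0∞ :=
  ∑ σ, ENNReal.ofReal (dist (M.a σ) (M.b σ) * |M.jump w σ|)

lemma measurable_cellFun [Fintype T] (w : T → ℝ) : Measurable (M.cellFun w) :=
  Finset.measurable_sum _ fun K _ =>
    measurable_const.indicator (M.isOpen_cell K).measurableSet

lemma eq_of_mem_cell {x : Plane} {K L : T} (hK : x ∈ M.cell K) (hL : x ∈ M.cell L) : K = L := by
  by_contra h
  exact (M.cell_disjoint K L h).ne_of_mem hK hL rfl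

lemma eq_of_mem_closure_cell {x : Plane} {K L : T} (hK : x ∈ closure (M.cell K))
    (hL : x ∈ M.cell L) : K = L := by
  by_contra h
  exact ((M.cell_disjoint K L h).closure_left (M.isOpen_cell L)).ne_of_mem hK hL rfl

lemma cellFun_of_mem [Fintype T] (w : T → ℝ) {x : Plane} {K : T} (hx : x ∈ M.cell K) :
    M.cellFun w x = ENNReal.ofReal (w K) := by
  rw [cellFun, Finset.sum_eq_single K]
  · simp [hx]
  · intro L _ hL
    exact indicator_of_notMem (fun h => hL (M.eq_of_mem_cell h hx)) _
  · simp

lemma ae_exists_mem_cell [Fintype T] : ∀ᵐ x : Plane, x ∈ Ω → ∃ K, x ∈ M.cell K := by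
  have h : ∀ᵐ x : Plane, ∀ K, x ∉ frontier (M.cell K) := by
    rw [ae_all_iff]
    intro K
    exact measure_eq_zero_iff_ae_notMem.1 ((M.convex_cell K).addHaar_frontier volume)
  filter_upwards [h] with x hx hxΩ
  have h1 : x ∈ closure (⋃ K, M.cell K) := by rw [M.closure_cells]; exact subset_closure hxΩ
  rw [closure_iUnion_of_finite, mem_iUnion] at h1
  obtain ⟨K, hK⟩ := h1
  refine ⟨K, ?_⟩
  by_contra hn
  exact hx K ⟨hK, by rwa [(M.isOpen_cell K).interior_eq]⟩

lemma ae_vertices_notMem_segment [Fintype E] (h : Plane) : ∀ᵐ x : Plane, ∀ σ,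
    M.a σ ∉ segment ℝ x (x + h) ∧ M.b σ ∉ segment ℝ x (x + h) := by
  have key : ∀ v : Plane, ∀ᵐ x : Plane, v ∉ segment ℝ x (x + h) := by
    intro v
    refine measure_mono_null ?_ (volume_segment v (v - h))
    intro x hx
    have hx : v ∈ segment ℝ x (x + h) := by simpa using hx
    rw [segment_eq_image'] at hx ⊢
    obtain ⟨t, ht, rfl⟩ := hx
    exact ⟨t, ht, by simp⟩
  rw [ae_all_iff]
  intro σ
  filter_upwards [key (M.a σ), key (M.b σ)] with x h1 h2 using ⟨h1, h2⟩

/-- Integrated over all starting points `x`, the sum of the jumps met on the way from `x` to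
`x + h` is at most `‖h‖` times the total variation. -/
lemma exists_measurable_sum_crossed_le [Fintype E] (w : T → ℝ) (h : Plane) :
    ∃ g : Plane → ℝ≥0∞, Measurable g ∧
      (∀ x, ENNReal.ofReal (∑ σ ∈ M.crossed x (x + h), |M.jump w σ|) ≤ g x) ∧
      ∫⁻ x, g x ≤ ‖h‖₊ * M.totalVar w := by
  set S : E → Set Plane := fun σ =>
    toMeasurable volume {x : Plane | (segment ℝ x (x + h) ∩ segment ℝ (M.a σ) (M.b σ)).Nonempty}
  have hS : ∀ σ, MeasurableSet (S σ) := fun σ => measurableSet_toMeasurable _ _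
  refine ⟨fun x => ∑ σ, (S σ).indicator (fun _ => ENNReal.ofReal |M.jump w σ|) x,
    Finset.measurable_sum _ fun σ _ => measurable_const.indicator (hS σ), fun x => ?_, ?_⟩
  · rw [ENNReal.ofReal_sum_of_nonneg fun _ _ => abs_nonneg _]
    calc _ = ∑ σ ∈ M.crossed x (x + h),
          (S σ).indicator (fun _ => ENNReal.ofReal |M.jump w σ|) x := by
          refine Finset.sum_congr rfl fun σ hσ => ?_
          rw [indicator_of_mem]
          exact subset_toMeasurable _ _ (M.mem_crossed.1 hσ)
      _ ≤ _ := Finset.sum_le_sum_of_subset (Finset.subset_univ _)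
  · rw [lintegral_finsetSum _ fun σ _ => measurable_const.indicator (hS σ), totalVar,
      Finset.mul_sum]
    refine Finset.sum_le_sum fun σ _ => ?_
    rw [lintegral_indicator_const (hS σ), measure_toMeasurable]
    calc _ ≤ ENNReal.ofReal |M.jump w σ| * ENNReal.ofReal (dist (M.a σ) (M.b σ) * ‖h‖) := by
          gcongr
          exact volume_shadow_le _ _ _
      _ = _ := by
          rw [ENNReal.ofReal_mul dist_nonneg, ENNReal.ofReal_mul dist_nonneg, ofReal_norm,
            enorm_eq_nnnorm]
          ring

/-- Moving the domain of integration `A` along `h` inside of `Ω` changes the integral of a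
piecewise constant function by at most `‖h‖` times its total variation. -/
lemma lintegral_translate_le [Fintype T] [Fintype E] (hΩ : IsOpen Ω) {w : T → ℝ}
    (hw : ∀ K, 0 ≤ w K) {A : Set Plane} (hA : MeasurableSet A) {h : Plane}
    (hAh : ∀ x ∈ A, segment ℝ x (x + h) ⊆ Ω) :
    ∫⁻ x in A, M.cellFun w (x + h) ≤ (∫⁻ x in A, M.cellFun w x) + ‖h‖₊ * M.totalVar w := by
  obtain ⟨g, -, hgle, hgint⟩ := M.exists_measurable_sum_crossed_le w h
  have hae : ∀ᵐ x ∂(volume.restrict A), M.cellFun w (x + h) ≤ M.cellFun w x + g x := by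
    rw [ae_restrict_iff' hA]
    have hcell := M.ae_exists_mem_cell
    filter_upwards [hcell,
      (measurePreserving_add_right volume h).quasiMeasurePreserving.ae hcell,
      M.ae_vertices_notMem_segment h] with x hx hxh hv hxA
    obtain ⟨K, hK⟩ := hx (hAh x hxA (left_mem_segment _ _ _))
    obtain ⟨L, hL⟩ := hxh (hAh x hxA (right_mem_segment _ _ _))
    obtain ⟨L', hL', hle⟩ := M.exists_abs_sub_le_sum_crossed hΩ w (y := x + h) hK
      (fun t ht => hAh x hxA (by
        rw [segment_eq_image']; exact ⟨t, ⟨ht.1, ht.2.le⟩, rfl⟩)) hv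
    obtain rfl := M.eq_of_mem_closure_cell hL' hL
    rw [M.cellFun_of_mem w hK, M.cellFun_of_mem w hL]
    calc ENNReal.ofReal (w L') ≤
          ENNReal.ofReal (w K + ∑ σ ∈ M.crossed x (x + h), |M.jump w σ|) := by
          refine ENNReal.ofReal_le_ofReal ?_
          linarith [neg_abs_le (w K - w L')]
      _ ≤ _ := by
          rw [ENNReal.ofReal_add (hw K) (Finset.sum_nonneg fun _ _ => abs_nonneg _)]
          gcongr
          exact hgle x
  calc _ ≤ ∫⁻ x in A, (M.cellFun w x + g x) := lintegral_mono_ae hae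
    _ = (∫⁻ x in A, M.cellFun w x) + ∫⁻ x in A, g x :=
        lintegral_add_left (M.measurable_cellFun w) _
    _ ≤ _ := by
        gcongr
        exact (setLIntegral_le_lintegral _ _).trans hgint

/-- Averaging `lintegral_translate_le` over `h`. -/
lemma volume_mul_lintegral_le [Fintype T] [Fintype E] (hΩ : IsOpen Ω) {w : T → ℝ}
    (hw : ∀ K, 0 ≤ w K) {A Q : Set Plane} (hA : MeasurableSet A) (hQ : MeasurableSet Q)
    (hAQ : A ⊆ Q) (hQc : Convex ℝ Q) (hQΩ : Q ⊆ Ω) {R : ℝ≥0}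
    (hR : ∀ x ∈ Q, ∀ y ∈ Q, ‖y - x‖₊ ≤ R) :
    volume A * ∫⁻ x in Q, M.cellFun w x ≤
      volume (Metric.closedBall (0 : Plane) R) *
        ((∫⁻ x in A, M.cellFun w x) + R * M.totalVar w) := by
  set F : Plane → Plane → ℝ≥0∞ := fun x h =>
    A.indicator 1 x * Q.indicator (M.cellFun w) (x + h)
  have hfQ : Measurable (Q.indicator (M.cellFun w)) := (M.measurable_cellFun w).indicator hQ
  have hF : Measurable (Function.uncurry F) :=
    ((measurable_one.indicator hA).comp measurable_fst).mul
      (hfQ.comp (measurable_fst.add measurable_snd))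
  have hleft : volume A * ∫⁻ x in Q, M.cellFun w x = ∫⁻ x, ∫⁻ h, F x h := by
    have : ∀ x, ∫⁻ h, F x h = A.indicator 1 x * ∫⁻ x in Q, M.cellFun w x := by
      intro x
      simp only [F]
      rw [lintegral_const_mul _ (f := fun h => Q.indicator (M.cellFun w) (x + h))
        (hfQ.comp (measurable_const_add x)),
        lintegral_add_left_eq_self (fun y => Q.indicator (M.cellFun w) y) x,
        lintegral_indicator hQ]
    simp_rw [this]
    rw [lintegral_mul_const _ (measurable_one.indicator hA), lintegral_indicator_one hA]
  have hinner : ∀ h, ∫⁻ x, F x h ≤ (Metric.closedBall (0 : Plane) R).indicator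
      (fun _ => (∫⁻ x in A, M.cellFun w x) + R * M.totalVar w) h := by
    intro h
    set B : Set Plane := A ∩ (fun x => x + h) ⁻¹' Q
    have hB : MeasurableSet B := hA.inter (measurable_add_const h hQ)
    have hFB : ∀ x, F x h = B.indicator (fun x => M.cellFun w (x + h)) x := by
      intro x
      by_cases h1 : x ∈ A <;> by_cases h2 : x + h ∈ Q <;> simp [F, B, h1, h2]
    simp_rw [hFB]
    rw [lintegral_indicator hB]
    by_cases hh : h ∈ Metric.closedBall (0 : Plane) R
    · rw [indicator_of_mem hh]
      have hhR : ‖h‖₊ ≤ R := by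
        rw [mem_closedBall_zero_iff] at hh
        exact_mod_cast hh
      refine (M.lintegral_translate_le hΩ hw hB fun x hx =>
        (hQc.segment_subset (hAQ hx.1) hx.2).trans hQΩ).trans ?_
      gcongr
      exact inter_subset_left
    · have : B = ∅ := by
        rw [eq_empty_iff_forall_notMem]
        intro x hx
        refine hh (mem_closedBall_zero_iff.2 ?_)
        have := hR x (hAQ hx.1) (x + h) hx.2
        rw [add_sub_cancel_left] at this
        exact_mod_cast this
      simp [this]
  rw [hleft, lintegral_lintegral_swap hF.aemeasurable]
  refine (lintegral_mono hinner).trans_eq ?_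
  rw [lintegral_indicator_const Metric.isClosed_closedBall.measurableSet, mul_comm]

end AdmissibleMesh

/-- On the set `A`, the `L¹` norm of nonnegative piecewise constant functions is controlled by the
total variation, uniformly for all meshes. -/
def HasBound (Ω ΓD A : Set Plane) : Prop :=
  ∃ C : ℝ≥0, ∀ (ΓN : Set Plane) (T E : Type) [Fintype T] [Fintype E]
    (M : AdmissibleMesh Ω ΓD ΓN T E), IsBoundarySplitting Ω ΓD ΓN →
    ∀ w : T → ℝ, (∀ K, 0 ≤ w K) → ∫⁻ x in A, M.cellFun w x ≤ C * M.totalVar w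

namespace HasBound

variable {Ω ΓD A B Q : Set Plane}

lemma mono_ae (hB : HasBound Ω ΓD B) (hAB : A ≤ᵐ[volume] B) : HasBound Ω ΓD A := by
  obtain ⟨C, hC⟩ := hB
  exact ⟨C, fun ΓN T E _ _ M hΓ w hw =>
    (lintegral_mono' (Measure.restrict_mono_ae hAB) le_rfl).trans (hC ΓN T E M hΓ w hw)⟩

lemma mono (hB : HasBound Ω ΓD B) (hAB : A ⊆ B) : HasBound Ω ΓD A :=
  hB.mono_ae (LE.le.eventuallyLE hAB)

lemma empty : HasBound Ω ΓD ∅ := ⟨0, by simp⟩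

lemma union (hA : HasBound Ω ΓD A) (hB : HasBound Ω ΓD B) : HasBound Ω ΓD (A ∪ B) := by
  obtain ⟨C, hC⟩ := hA
  obtain ⟨D, hD⟩ := hB
  refine ⟨C + D, fun ΓN T E _ _ M hΓ w hw => (lintegral_union_le _ _ _).trans ?_⟩
  rw [ENNReal.coe_add, add_mul]
  exact add_le_add (hC ΓN T E M hΓ w hw) (hD ΓN T E M hΓ w hw)

lemma biUnion {ι : Type*} (s : Finset ι) (F : ι → Set Plane)
    (h : ∀ i ∈ s, HasBound Ω ΓD (F i)) : HasBound Ω ΓD (⋃ i ∈ s, F i) := by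
  induction s using Finset.induction_on with
  | empty => simpa using empty
  | insert i s _ ih =>
    rw [Finset.set_biUnion_insert]
    exact (h i (by simp)).union (ih fun j hj => h j (by simp [hj]))

/-- The bound propagates from a part of positive measure to any bounded convex set in `Ω`. -/
lemma of_convex (hA : HasBound Ω ΓD A) (hΩ : IsOpen Ω) (hAm : MeasurableSet A)
    (hA0 : volume A ≠ 0) (hQ : MeasurableSet Q) (hAQ : A ⊆ Q) (hQc : Convex ℝ Q)
    (hQb : Bornology.IsBounded Q) (hQΩ : Q ⊆ Ω) : HasBound Ω ΓD Q := by
  obtain ⟨C, hC⟩ := hA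
  obtain ⟨R, hR⟩ : ∃ R : ℝ≥0, ∀ x ∈ Q, ∀ y ∈ Q, ‖y - x‖₊ ≤ R := by
    refine ⟨⟨Metric.diam Q, Metric.diam_nonneg⟩, fun x hx y hy => ?_⟩
    have := Metric.dist_le_diam_of_mem hQb hy hx
    rw [dist_eq_norm] at this
    exact_mod_cast this
  have hAtop : volume A ≠ ⊤ := ((measure_mono hAQ).trans_lt hQb.measure_lt_top).ne
  have hBtop : volume (Metric.closedBall (0 : Plane) R) ≠ ⊤ := measure_closedBall_lt_top.ne
  set D : ℝ≥0∞ := (volume A)⁻¹ * (volume (Metric.closedBall (0 : Plane) R) * (C + R))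
  have hD : D ≠ ⊤ := ENNReal.mul_ne_top (ENNReal.inv_ne_top.2 hA0)
    (ENNReal.mul_ne_top hBtop (by simp))
  refine ⟨D.toNNReal, fun ΓN T E _ _ M hΓ w hw => ?_⟩
  rw [ENNReal.coe_toNNReal hD]
  have h1 := M.volume_mul_lintegral_le hΩ hw hAm hQ hAQ hQc hQΩ hR
  calc ∫⁻ x in Q, M.cellFun w x
      = (volume A)⁻¹ * (volume A * ∫⁻ x in Q, M.cellFun w x) := by
        rw [← mul_assoc, ENNReal.inv_mul_cancel hA0 hAtop, one_mul]
    _ ≤ (volume A)⁻¹ * (volume (Metric.closedBall (0 : Plane) R) *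
        (C * M.totalVar w + R * M.totalVar w)) := by
        gcongr (volume A)⁻¹ * ?_
        refine h1.trans ?_
        gcongr
        exact hC ΓN T E M hΓ w hw
    _ = D * M.totalVar w := by simp only [D]; ring

/-- By connectedness, the bound propagates from one ball to the whole domain. -/
lemma of_ball (hΩ : IsPolygonalDomain Ω) {x₀ : Plane} {r₀ : ℝ} (hr₀ : 0 < r₀)
    (hball : Metric.ball x₀ r₀ ⊆ Ω) (h : HasBound Ω ΓD (Metric.ball x₀ r₀)) :
    HasBound Ω ΓD Ω := by
  set U : Set Plane := {y | ∃ x r, y ∈ Metric.ball x r ∧ Metric.ball x r ⊆ Ω ∧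
    HasBound Ω ΓD (Metric.ball x r)}
  have hU : IsOpen U := by
    rw [isOpen_iff_mem_nhds]
    rintro y ⟨x, r, hy, hsub, hb⟩
    filter_upwards [Metric.isOpen_ball.mem_nhds hy] with z hz
    exact ⟨x, r, hz, hsub, hb⟩
  have hprop : ∀ Q : Set Plane, IsOpen Q → Convex ℝ Q → Bornology.IsBounded Q → Q ⊆ Ω →
      (Q ∩ U).Nonempty → HasBound Ω ΓD Q := by
    rintro Q hQ hQc hQb hQΩ ⟨y, hyQ, x, r, hy, -, hb⟩
    refine of_convex (A := Metric.ball x r ∩ Q) (hb.mono inter_subset_left) hΩ.isOpen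
      (Metric.isOpen_ball.inter hQ).measurableSet ?_ hQ.measurableSet inter_subset_right hQc hQb hQΩ
    exact ((Metric.isOpen_ball.inter hQ).measure_pos volume ⟨y, hy, hyQ⟩).ne'
  have hΩU : Ω ⊆ U := by
    refine hΩ.1.isPreconnected.subset_of_closure_inter_subset hU
      ⟨x₀, hball (Metric.mem_ball_self hr₀), x₀, r₀, Metric.mem_ball_self hr₀, hball, h⟩ ?_
    rintro x ⟨hxU, hxΩ⟩
    obtain ⟨r, hr, hrΩ⟩ := Metric.isOpen_iff.1 hΩ.isOpen x hxΩ
    refine ⟨x, r, Metric.mem_ball_self hr, hrΩ, ?_⟩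
    refine hprop _ Metric.isOpen_ball (convex_ball _ _) Metric.isBounded_ball hrΩ ?_
    exact mem_closure_iff.1 hxU _ Metric.isOpen_ball (Metric.mem_ball_self hr)
  obtain ⟨S, hS⟩ := hΩ.2
  have hsub : ∀ s ∈ S, interior (convexHull ℝ (s : Set Plane)) ⊆ Ω := fun s hs => by
    rw [hS]
    exact interior_mono (subset_biUnion_of_mem (u := fun s : Finset Plane =>
      convexHull ℝ (s : Set Plane)) hs)
  have hfin : HasBound Ω ΓD (⋃ s ∈ S, interior (convexHull ℝ (s : Set Plane))) := by
    refine biUnion S _ fun s hs => ?_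
    rcases eq_empty_or_nonempty (interior (convexHull ℝ (s : Set Plane))) with he | ⟨y, hy⟩
    · rw [he]; exact empty
    · refine hprop _ isOpen_interior (convex_convexHull ℝ _).interior
        ((s.finite_toSet.isCompact_convexHull ℝ).isBounded.subset interior_subset) (hsub s hs)
        ⟨y, hy, hΩU (hsub s hs hy)⟩
  refine hfin.mono_ae ?_
  have hae : ∀ᵐ x : Plane, ∀ s ∈ S, x ∉ frontier (convexHull ℝ (s : Set Plane)) := by
    rw [Filter.eventually_all_finset]
    intro s _
    exact measure_eq_zero_iff_ae_notMem.1 ((convex_convexHull ℝ _).addHaar_frontier volume)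
  filter_upwards [hae] with x hx hxΩ
  have hxΩ' : x ∈ ⋃ s ∈ S, convexHull ℝ (s : Set Plane) := by
    have : x ∈ Ω := hxΩ
    rw [hS] at this
    exact interior_subset this
  simp only [mem_iUnion, exists_prop] at hxΩ'
  obtain ⟨s, hs, hxs⟩ := hxΩ'
  have : x ∈ interior (convexHull ℝ (s : Set Plane)) := by
    by_contra hn
    exact hx s hs ⟨subset_closure hxs, hn⟩
  exact mem_biUnion (s := (S : Set (Finset Plane))) hs this

end HasBound

/-! ### The discrete `L¹` Poincaré inequality -/

/-- A boundary edge of any mesh that meets, inside both segments, a segment of `ΓD` bordering `Ω`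
(the open convex set `C ⊆ Ω` lies along it) is a Dirichlet edge. -/
lemma AdmissibleMesh.isDirichlet_of_mem {Ω ΓD ΓN : Set Plane} {T E : Type}
    (M : AdmissibleMesh Ω ΓD ΓN T E) (hΩ : IsOpen Ω) (hΓ : IsBoundarySplitting Ω ΓD ΓN)
    {C : Set Plane} (hC : Convex ℝ C) (hCo : IsOpen C) (hCΩ : C ⊆ Ω) {a b c : Plane} (hab : a ≠ b)
    (hseg : segment ℝ a b ⊆ frontier C) (hD : openSegment ℝ a b ⊆ ΓD) (hc : c ∈ C) {y : Plane}
    (hy : y ∈ openSegment ℝ a b) {σ : E} (hσ : M.cell₂ σ = none)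
    (hyσ : y ∈ openSegment ℝ (M.a σ) (M.b σ)) : M.IsDirichlet σ := by
  refine ⟨hσ, (M.boundary_split σ hσ).resolve_right fun hN => ?_⟩
  have hk := cross_ne_zero_of_segment_subset_frontier hC hCo hab hseg hc hy
  have hlineσ := eventually_mem_openSegment_of_cross_eq_zero (M.a_ne_b σ) hyσ
  have htend : ∀ v : Plane, Tendsto (fun t : ℝ => y + t • v) (𝓝 0) (𝓝 y) := by
    intro v
    have : ContinuousAt (fun t : ℝ => y + t • v) 0 := by fun_prop
    simpa [ContinuousAt] using this
  by_cases hpar : cross (b - a) (M.b σ - M.a σ) = 0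
  · -- parallel segments overlap on a set of positive length contained in `ΓD ∩ ΓN`
    have hline := eventually_mem_openSegment_of_cross_eq_zero hab hy
    obtain ⟨ε, hε, hball⟩ := Metric.eventually_nhds_iff_ball.1 (hline.and hlineσ)
    obtain ⟨t, ht, ht0⟩ := ((((htend (b - a)).mono_left nhdsWithin_le_nhds).eventually
      (Metric.ball_mem_nhds y hε)).and (self_mem_nhdsWithin (s := Ioi (0 : ℝ)))).exists
    have ht0 : 0 < t := ht0
    have hsub : segment ℝ y (y + t • (b - a)) ⊆ ΓD ∩ ΓN := by
      intro p hp
      have hpb := (convex_ball y ε).segment_subset (Metric.mem_ball_self hε) ht hp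
      obtain ⟨h1, h2⟩ := hball p hpb
      rw [segment_eq_image'] at hp
      obtain ⟨s, -, rfl⟩ := hp
      refine ⟨hD (h1 ?_), hN (h2 ?_)⟩
      · simp [cross_smul_right, cross_self]
      · have : cross (M.b σ - M.a σ) (b - a) = -cross (b - a) (M.b σ - M.a σ) := by
          simp [cross]; ring
        simp [cross_smul_right, this, hpar]
    have hzero := measure_mono_null hsub hΓ.2
    rw [hausdorffMeasure_segment, edist_eq_zero] at hzero
    have : t • (b - a) = 0 := by simpa using hzero
    rcases smul_eq_zero.1 this with h | h
    · exact ht0.ne' h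
    · exact hab (sub_eq_zero.1 h).symm
  · -- transversal segments are impossible, as `σ` would enter `C`
    set u := M.b σ - M.a σ
    set δ : ℝ := cross (b - a) u * cross (b - a) (c - y)
    have hside := eventually_mem_of_cross_pos hC hCo
      (frontier_subset_closure (hseg (left_mem_segment _ _ _)))
      (frontier_subset_closure (hseg (right_mem_segment _ _ _))) hc hy
    obtain ⟨t, ⟨h1, h2⟩, ht0⟩ := ((((htend (δ • u)).mono_left nhdsWithin_le_nhds).eventually
      (hside.and hlineσ)).and (self_mem_nhdsWithin (s := Ioi (0 : ℝ)))).exists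
    have ht0 : 0 < t := ht0
    simp only [add_sub_cancel_left, cross_smul_right, cross_self, mul_zero] at h1 h2
    have hδ : δ ≠ 0 := mul_ne_zero hpar hk
    have hmem := h1 (by
      have : t * (δ * cross (b - a) u) * cross (b - a) (c - y) = t * δ ^ 2 := by
        simp only [δ]; ring
      rw [this]; positivity)
    have hfr := M.boundary_edge σ hσ (openSegment_subset_segment _ _ _ (h2 trivial))
    rw [frontier, hΩ.interior_eq] at hfr
    exact hfr.2 (hCΩ hmem)

/-- The bound holds near a boundary segment contained in `ΓD`: follow straight lines to this
segment. -/
lemma HasBound.exists_ball {Ω ΓD : Set Plane} (hΩ : IsPolygonalDomain Ω)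
    {C : Set Plane} (hC : Convex ℝ C) (hCo : IsOpen C) (hCΩ : C ⊆ Ω) {a b c : Plane} (hab : a ≠ b)
    (hseg : segment ℝ a b ⊆ frontier C) (hsegΩ : segment ℝ a b ⊆ frontier Ω)
    (hD : openSegment ℝ a b ⊆ ΓD) (hc : c ∈ C) :
    ∃ r > 0, Metric.ball c r ⊆ Ω ∧ HasBound Ω ΓD (Metric.ball c r) := by
  have hmid : midpoint ℝ a b ∈ openSegment ℝ a b := by
    rw [openSegment_eq_image']
    refine ⟨1 / 2, by norm_num, ?_⟩
    rw [midpoint_eq_smul_add, invOf_eq_inv]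
    module
  set z := midpoint ℝ a b
  have hk := cross_ne_zero_of_segment_subset_frontier hC hCo hab hseg hc hmid
  set h : Plane := (2 : ℝ) • (z - c) with hh
  -- `x + τ x • h` is the point of the line `ab` on the line through `x` directed by `h`
  set τ : Plane → ℝ := fun x => cross (b - a) (x - z) / (2 * cross (b - a) (c - z))
  have hτ : Continuous τ :=
    ((continuous_cross_right (b - a)).comp (continuous_id.sub continuous_const)).div_const _
  have hτc : τ c = 1 / 2 := by simp only [τ]; field_simp
  have hline : ∀ x, cross (b - a) (x + τ x • h - z) = 0 := by
    intro x
    have e1 : x + τ x • h - z = (x - z) - (2 * τ x) • (c - z) := by rw [hh]; module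
    rw [e1, cross_sub_right, cross_smul_right]
    simp only [τ]; field_simp; ring
  have hcont : Continuous fun x => x + τ x • h := by fun_prop
  have hcz : c + τ c • h = z := by rw [hτc, hh]; module
  have hev : ∀ᶠ x in 𝓝 c, x ∈ C ∧ τ x ∈ Ioo (0 : ℝ) 1 ∧ x + τ x • h ∈ openSegment ℝ a b := by
    have h1 := eventually_mem_openSegment_of_cross_eq_zero hab hmid
    have h2 : Tendsto (fun x => x + τ x • h) (𝓝 c) (𝓝 z) := by
      have := hcont.tendsto c
      rwa [hcz] at this
    filter_upwards [hCo.mem_nhds hc, hτ.continuousAt.eventually_mem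
      (Ioo_mem_nhds (a := 0) (b := 1) (by rw [hτc]; norm_num) (by rw [hτc]; norm_num)),
      h2.eventually h1] with x hx1 hx2 hx3
    exact ⟨hx1, hx2, hx3 (hline x)⟩
  obtain ⟨r, hr, hball⟩ := Metric.eventually_nhds_iff_ball.1 hev
  refine ⟨r, hr, fun x hx => hCΩ (hball x hx).1, 2 * ‖h‖₊, fun ΓN T E _ _ M hΓ w hw => ?_⟩
  obtain ⟨g, hg, hgle, hgint⟩ := M.exists_measurable_sum_crossed_le w h
  have hae : ∀ᵐ x ∂(volume.restrict (Metric.ball c r)), M.cellFun w x ≤ 2 * g x := by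
    rw [ae_restrict_iff' Metric.isOpen_ball.measurableSet]
    filter_upwards [M.ae_exists_mem_cell, M.ae_vertices_notMem_segment h] with x hx hv hxb
    obtain ⟨hxC, hτx, hyo⟩ := hball x hxb
    set y := x + τ x • h with hy
    obtain ⟨K, hK⟩ := hx (hCΩ hxC)
    have hyC : y ∈ closure C :=
      frontier_subset_closure (hseg (openSegment_subset_segment _ _ _ hyo))
    have hyΩ : y ∈ frontier Ω := hsegΩ (openSegment_subset_segment _ _ _ hyo)
    have hxy : ∀ t ∈ Ico (0 : ℝ) 1, x + t • (y - x) ∈ Ω := by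
      intro t ht
      have := hC.combo_interior_closure_mem_interior (x := x) (by rwa [hCo.interior_eq]) hyC
        (a := 1 - t) (b := t) (by linarith [ht.2]) ht.1 (by ring)
      rw [hCo.interior_eq] at this
      convert hCΩ this using 1
      module
    have hyseg : y ∈ segment ℝ x (x + h) := by
      rw [segment_eq_image']
      exact ⟨τ x, ⟨hτx.1.le, hτx.2.le⟩, by simp [hy]⟩
    have hsub : segment ℝ x y ⊆ segment ℝ x (x + h) :=
      (convex_segment _ _).segment_subset (left_mem_segment _ _ _) hyseg
    obtain ⟨L, hL, hle⟩ := M.exists_abs_sub_le_sum_crossed hΩ.isOpen w hK hxy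
      (fun σ => ⟨fun hm => (hv σ).1 (hsub hm), fun hm => (hv σ).2 (hsub hm)⟩)
    have hynΩ : y ∉ Ω := by
      rw [frontier, hΩ.isOpen.interior_eq] at hyΩ
      exact hyΩ.2
    have hyL : y ∈ frontier (M.cell L) :=
      ⟨hL, by rw [(M.isOpen_cell L).interior_eq]; exact fun hm => hynΩ (M.cell_subset L hm)⟩
    obtain ⟨σ, hσL, hyσ⟩ := M.exists_edge_of_mem_frontier hyL
    have hyσo : y ∈ openSegment ℝ (M.a σ) (M.b σ) := by
      refine mem_openSegment_of_ne_left_right ?_ ?_ hyσ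
      · intro hm; exact (hv σ).1 (hm ▸ hyseg)
      · intro hm; exact (hv σ).2 (hm ▸ hyseg)
    have hσ : M.cell₂ σ = none := by
      by_contra hne
      obtain ⟨L', hL'⟩ := Option.ne_none_iff_exists'.1 hne
      exact hynΩ (M.openSegment_subset_domain hΩ hL' hyσo)
    have hdir := M.isDirichlet_of_mem hΩ.isOpen hΓ hC hCo hCΩ hab hseg hD hc hyo hσ hyσo
    have hcell : M.cell₁ σ = L := by
      rcases hσL with h1 | h1
      · exact h1
      · rw [hσ] at h1; cases h1
    have hmem : σ ∈ M.crossed x (x + h) := M.mem_crossed.2 ⟨y, hyseg, hyσ⟩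
    have hjump : w L ≤ ∑ σ ∈ M.crossed x (x + h), |M.jump w σ| := by
      refine le_trans ?_ (Finset.single_le_sum (f := fun σ => |M.jump w σ|)
        (fun _ _ => abs_nonneg _) hmem)
      rw [M.jump_of_isDirichlet w hdir, hcell, abs_neg]
      exact le_abs_self _
    have hmono : ∑ σ ∈ M.crossed x y, |M.jump w σ| ≤
        ∑ σ ∈ M.crossed x (x + h), |M.jump w σ| := by
      refine Finset.sum_le_sum_of_subset_of_nonneg (fun τ hτ => ?_) fun _ _ _ => abs_nonneg _
      obtain ⟨p, hp, hpτ⟩ := M.mem_crossed.1 hτ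
      exact M.mem_crossed.2 ⟨p, hsub hp, hpτ⟩
    rw [M.cellFun_of_mem w hK]
    calc ENNReal.ofReal (w K) ≤
          ENNReal.ofReal (2 * ∑ σ ∈ M.crossed x (x + h), |M.jump w σ|) := by
          refine ENNReal.ofReal_le_ofReal ?_
          linarith [le_abs_self (w K - w L)]
      _ ≤ _ := by
          rw [ENNReal.ofReal_mul (by norm_num), ENNReal.ofReal_ofNat]
          gcongr
          exact hgle x
  calc _ ≤ ∫⁻ x in Metric.ball c r, 2 * g x := lintegral_mono_ae hae
    _ = 2 * ∫⁻ x in Metric.ball c r, g x := lintegral_const_mul _ hg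
    _ ≤ 2 * (‖h‖₊ * M.totalVar w) := by
        gcongr
        exact (setLIntegral_le_lintegral _ _).trans hgint
    _ = _ := by push_cast; ring

namespace AdmissibleMesh

variable {Ω ΓD ΓN : Set Plane} {T E : Type} (M : AdmissibleMesh Ω ΓD ΓN T E)

lemma area_nonneg (K : T) : 0 ≤ M.area K := measureReal_nonneg

lemma ofReal_sum_area_mul_le [Fintype T] {w : T → ℝ} (hw : ∀ K, 0 ≤ w K) :
    ENNReal.ofReal (∑ K, M.area K * w K) ≤ ∫⁻ x in Ω, M.cellFun w x := by
  rw [ENNReal.ofReal_sum_of_nonneg fun K _ => mul_nonneg (M.area_nonneg K) (hw K)]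
  simp only [cellFun]
  rw [lintegral_finsetSum _ fun K _ => measurable_const.indicator (M.isOpen_cell K).measurableSet]
  refine Finset.sum_le_sum fun K _ => ?_
  rw [lintegral_indicator_const (M.isOpen_cell K).measurableSet,
    Measure.restrict_apply (M.isOpen_cell K).measurableSet,
    inter_eq_left.2 (M.cell_subset K), ENNReal.ofReal_mul (M.area_nonneg K), area, Measure.real,
    ENNReal.ofReal_toReal (M.isBounded_cell K).measure_lt_top.ne, mul_comm]

end AdmissibleMesh

/-- Discrete `L¹` Poincaré inequality with Dirichlet conditions on a part of the boundary, with a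
constant that is uniform for all meshes. -/
lemma exists_l1_poincare {Ω ΓD : Set Plane} (hΩ : IsPolygonalDomain Ω) :
    ∃ C : ℝ, 0 < C ∧ ∀ (ΓN : Set Plane) (T E : Type) [Fintype T] [Fintype E]
      (M : AdmissibleMesh Ω ΓD ΓN T E), IsBoundarySplitting Ω ΓD ΓN → (∃ σ, M.IsDirichlet σ) →
      ∀ w : T → ℝ, (∀ K, 0 ≤ w K) →
        ∑ K, M.area K * w K ≤ C * ∑ σ, dist (M.a σ) (M.b σ) * |M.jump w σ| := by
  -- the starting segment of `ΓD` is an edge of any one mesh having a Dirichlet edge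
  by_cases hex : ∃ (ΓN : Set Plane) (T E : Type) (M : AdmissibleMesh Ω ΓD ΓN T E) (σ : E),
      M.IsDirichlet σ
  · obtain ⟨ΓN, T, E, M, σ, hσ⟩ := hex
    obtain ⟨r, hr, hrΩ, hb⟩ := HasBound.exists_ball hΩ (M.convex_cell (M.cell₁ σ))
      (M.isOpen_cell _) (M.cell_subset _) (M.a_ne_b σ) (M.edge_subset_frontier (Or.inl rfl))
      (M.boundary_edge σ hσ.1) hσ.2 (M.center_mem _)
    obtain ⟨C, hC⟩ := HasBound.of_ball hΩ hr hrΩ hb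
    refine ⟨C + 1, by positivity, fun ΓN T E _ _ M hΓ _ w hw => ?_⟩
    have h0 : ∀ σ, 0 ≤ dist (M.a σ) (M.b σ) * |M.jump w σ| := fun σ => by positivity
    have hS : 0 ≤ ∑ σ, dist (M.a σ) (M.b σ) * |M.jump w σ| := Finset.sum_nonneg fun σ _ => h0 σ
    have h1 := (M.ofReal_sum_area_mul_le hw).trans (hC ΓN T E M hΓ w hw)
    rw [AdmissibleMesh.totalVar, ← ENNReal.ofReal_sum_of_nonneg fun σ _ => h0 σ,
      ← ENNReal.ofReal_coe_nnreal, ← ENNReal.ofReal_mul C.coe_nonneg,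
      ENNReal.ofReal_le_ofReal_iff (by positivity)] at h1
    linarith
  · exact ⟨1, one_pos, fun ΓN T E _ _ M _ ⟨σ, hσ⟩ => absurd ⟨ΓN, T, E, M, σ, hσ⟩ hex⟩

/-! ### The discrete `L²` Poincaré inequality -/

namespace AdmissibleMesh

variable {Ω ΓD ΓN : Set Plane} {T E : Type} (M : AdmissibleMesh Ω ΓD ΓN T E)

lemma mem_edgesOf [Fintype E] {K : T} {σ : E} : σ ∈ M.edgesOf K ↔ M.IsEdgeOf σ K := by
  simp [edgesOf, IsEdgeOf]

lemma center_notMem_affineSpan {σ : E} {K : T} (h : M.IsEdgeOf σ K) :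
    M.center K ∉ (affineSpan ℝ {M.a σ, M.b σ} : Set Plane) := by
  intro hm
  have hdir := AffineSubspace.vsub_mem_direction hm (left_mem_affineSpan_pair ℝ (M.a σ) (M.b σ))
  rw [direction_affineSpan, mem_vectorSpan_pair_rev] at hdir
  obtain ⟨t, ht⟩ := hdir
  have hmid : M.a σ + (1 / 2 : ℝ) • (M.b σ - M.a σ) ∈ openSegment ℝ (M.a σ) (M.b σ) := by
    rw [openSegment_eq_image']
    exact ⟨1 / 2, by norm_num, rfl⟩
  refine M.cross_center_ne_zero h hmid ?_
  rw [vsub_eq_sub, vsub_eq_sub] at ht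
  have : M.center K - (M.a σ + (1 / 2 : ℝ) • (M.b σ - M.a σ)) =
      (t - 1 / 2) • (M.b σ - M.a σ) := by rw [← sub_sub, ← ht]; module
  rw [this, cross_smul_right, cross_self, mul_zero]

lemma distToEdge_pos {σ : E} {K : T} (h : M.IsEdgeOf σ K) : 0 < M.distToEdge K σ := by
  have hclosed : IsClosed (affineSpan ℝ {M.a σ, M.b σ} : Set Plane) :=
    AffineSubspace.closed_of_finiteDimensional _
  exact (hclosed.notMem_iff_infDist_pos ⟨M.a σ, left_mem_affineSpan_pair ℝ _ _⟩).1
    (M.center_notMem_affineSpan h)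

lemma dEdge_pos (σ : E) : 0 < M.dEdge σ := by
  unfold dEdge
  split
  · next L hL =>
    have hne : M.cell₁ σ ≠ L := fun h => M.cell₂_ne σ (by rw [hL, h])
    exact dist_pos.2 ((M.cell_disjoint _ _ hne).ne_of_mem (M.center_mem _) (M.center_mem _))
  · exact M.distToEdge_pos (Or.inl rfl)

lemma trans_pos (σ : E) : 0 < M.trans σ := div_pos (dist_pos.2 (M.a_ne_b σ)) (M.dEdge_pos σ)

/-- A double sum over control volumes and their edges, written as a sum over edges. -/
lemma sum_sum_edgesOf [Fintype T] [Fintype E] (f : T → E → ℝ) :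
    ∑ K, ∑ σ ∈ M.edgesOf K, f K σ =
      ∑ σ, (f (M.cell₁ σ) σ + (M.cell₂ σ).elim 0 fun L => f L σ) := by
  have h1 : ∀ K, ∑ σ ∈ M.edgesOf K, f K σ =
      ∑ σ, ((if M.cell₁ σ = K then f K σ else 0) + if M.cell₂ σ = some K then f K σ else 0) := by
    intro K
    rw [edgesOf, Finset.sum_filter]
    refine Finset.sum_congr rfl fun σ _ => ?_
    by_cases h1 : M.cell₁ σ = K
    · have h2 : M.cell₂ σ ≠ some K := fun h2 => M.cell₂_ne σ (by rw [h2, h1])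
      simp [h1, h2]
    · simp [h1]
  simp_rw [h1]
  rw [Finset.sum_comm]
  refine Finset.sum_congr rfl fun σ _ => ?_
  rw [Finset.sum_add_distrib, Finset.sum_ite_eq]
  cases h : M.cell₂ σ <;> simp

/-- The triangle spanned by the center of `K` and an edge. -/
def triangle (K : T) (σ : E) : Set Plane := convexHull ℝ {M.center K, M.a σ, M.b σ}

lemma exists_of_mem_triangle {K : T} {σ : E} {p : Plane} (hp : p ∈ M.triangle K σ) :
    ∃ z ∈ segment ℝ (M.a σ) (M.b σ), p ∈ segment ℝ (M.center K) z := by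
  rw [triangle, convexHull_insert (by simp), convexHull_pair, convexJoin_singleton_left] at hp
  simpa using hp

lemma triangle_subset {K : T} {σ : E} (h : M.IsEdgeOf σ K) :
    M.triangle K σ ⊆ closure (M.cell K) := by
  refine convexHull_min ?_ (M.convex_cell K).closure
  rintro x (rfl | rfl | rfl)
  · exact subset_closure (M.center_mem K)
  · exact M.a_mem_closure h
  · exact M.b_mem_closure h

/-- A ray issued from the center of `K` meets the boundary of `K` at a single point. -/
lemma eq_of_mem_segment_center {K : T} {z z' p : Plane} (hz : z ∈ frontier (M.cell K))
    (hz' : z' ∈ frontier (M.cell K)) (hp : p ∈ segment ℝ (M.center K) z)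
    (hp' : p ∈ segment ℝ (M.center K) z') : p = M.center K ∨ z = z' := by
  rw [segment_eq_image'] at hp hp'
  obtain ⟨s, hs, rfl⟩ := hp
  obtain ⟨s', hs', he⟩ := hp'
  have key : ∀ {s s' : ℝ} {z z' : Plane}, 0 ≤ s → s < s' → z ∈ frontier (M.cell K) →
      z' ∈ frontier (M.cell K) →
      M.center K + s' • (z' - M.center K) = M.center K + s • (z - M.center K) → False := by
    intro s s' z z' hs hss hz hz' he
    have hs'0 : 0 < s' := hs.trans_lt hss
    have hz'eq : z' = (1 - s / s') • M.center K + (s / s') • z := by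
      have h1 : z' - M.center K = (s / s') • (z - M.center K) := by
        rw [div_eq_inv_mul, mul_smul, ← add_left_cancel he, smul_smul,
          inv_mul_cancel₀ hs'0.ne', one_smul]
      rw [← sub_add_cancel z' (M.center K), h1]; module
    have hmem := (M.convex_cell K).combo_interior_closure_mem_interior (x := M.center K)
      (by rw [(M.isOpen_cell K).interior_eq]; exact M.center_mem K)
      (frontier_subset_closure hz) (a := 1 - s / s') (b := s / s')
      (by rw [sub_pos, div_lt_one hs'0]; exact hss) (by positivity) (by ring)
    rw [← hz'eq] at hmem
    exact hz'.2 hmem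
  rcases lt_trichotomy s s' with h | h | h
  · exact (key hs.1 h hz hz' he).elim
  · subst h
    rcases eq_or_ne s 0 with rfl | h0
    · left; simp
    · right
      exact (sub_left_injective (smul_right_injective Plane h0 (add_left_cancel he))).symm
  · exact (key hs'.1 h hz' hz he.symm).elim

lemma aedisjoint_triangle {K : T} {σ τ : E} (hσ : M.IsEdgeOf σ K) (hτ : M.IsEdgeOf τ K)
    (hστ : σ ≠ τ) : AEDisjoint volume (M.triangle K σ) (M.triangle K τ) := by
  have hsub : M.triangle K σ ∩ M.triangle K τ ⊆
      (segment ℝ (M.center K) (M.a σ) ∪ segment ℝ (M.center K) (M.b σ)) ∪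
        (segment ℝ (M.center K) (M.a τ) ∪ segment ℝ (M.center K) (M.b τ)) := by
    rintro p ⟨h1, h2⟩
    obtain ⟨z, hz, hp⟩ := M.exists_of_mem_triangle h1
    obtain ⟨z', hz', hp'⟩ := M.exists_of_mem_triangle h2
    rcases M.eq_of_mem_segment_center (M.edge_subset_frontier hσ hz)
      (M.edge_subset_frontier hτ hz') hp hp' with rfl | rfl
    · exact mem_union_left _ (mem_union_left _ (left_mem_segment _ _ _))
    · by_cases e1 : z = M.a σ
      · exact mem_union_left _ (mem_union_left _ (e1 ▸ hp))
      by_cases e2 : z = M.b σ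
      · exact mem_union_left _ (mem_union_right _ (e2 ▸ hp))
      by_cases e3 : z = M.a τ
      · exact mem_union_right _ (mem_union_left _ (e3 ▸ hp))
      by_cases e4 : z = M.b τ
      · exact mem_union_right _ (mem_union_right _ (e4 ▸ hp))
      exact ((M.edge_disjoint σ τ hστ).ne_of_mem
        (mem_openSegment_of_ne_left_right (Ne.symm e1) (Ne.symm e2) hz)
        (mem_openSegment_of_ne_left_right (Ne.symm e3) (Ne.symm e4) hz') rfl).elim
  refine measure_mono_null hsub ?_
  simp [volume_segment]

/-- The triangles spanned by the center of `K` and the edges of `K` do not overlap; hence the sum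
of their areas `m_σ d(x_K, σ) / 2` is at most the area of `K`. -/
lemma sum_dist_mul_distToEdge_le [Fintype E] (K : T) :
    ∑ σ ∈ M.edgesOf K, dist (M.a σ) (M.b σ) * M.distToEdge K σ ≤ 2 * M.area K := by
  have hcomp : ∀ σ, IsCompact (M.triangle K σ) := fun σ =>
    (Set.toFinite ({M.center K, M.a σ, M.b σ} : Set Plane)).isCompact_convexHull ℝ
  have hsum : ∑ σ ∈ M.edgesOf K, (volume : Measure Plane).real (M.triangle K σ) ≤ M.area K := by
    have hU : volume (⋃ σ ∈ M.edgesOf K, M.triangle K σ) =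
        ∑ σ ∈ M.edgesOf K, volume (M.triangle K σ) := by
      refine measure_biUnion_finset₀ ?_ fun σ _ => (hcomp σ).measurableSet.nullMeasurableSet
      intro σ hσ τ hτ hne
      exact M.aedisjoint_triangle (M.mem_edgesOf.1 hσ) (M.mem_edgesOf.1 hτ) hne
    have hle : ∑ σ ∈ M.edgesOf K, volume (M.triangle K σ) ≤ volume (M.cell K) := by
      have hsub : ⋃ σ ∈ M.edgesOf K, M.triangle K σ ⊆ M.cell K ∪ frontier (M.cell K) := by
        rw [← closure_eq_self_union_frontier]
        exact iUnion₂_subset fun σ hσ => M.triangle_subset (M.mem_edgesOf.1 hσ)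
      have h0 : volume (frontier (M.cell K)) = 0 := (M.convex_cell K).addHaar_frontier volume
      have h1 := (measure_mono (μ := volume) hsub).trans (measure_union_le _ _)
      rwa [hU, h0, add_zero] at h1
    have h2 := ENNReal.toReal_mono (M.isBounded_cell K).measure_lt_top.ne hle
    rwa [ENNReal.toReal_sum fun σ _ => (hcomp σ).measure_lt_top.ne] at h2
  have hedge : ∀ σ, dist (M.a σ) (M.b σ) * M.distToEdge K σ ≤
      2 * (volume : Measure Plane).real (M.triangle K σ) := fun σ =>
    (dist_mul_infDist_le_abs_cross (M.a_ne_b σ) _).trans (abs_cross_le_two_mul_volume _ _ _)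
  refine (Finset.sum_le_sum fun σ _ => hedge σ).trans ?_
  rw [← Finset.mul_sum]
  linarith

lemma sq_jump_sq_le (v : T → ℝ) (σ : E) :
    M.jump (fun K => v K ^ 2) σ ^ 2 ≤
      2 * (v (M.cell₁ σ) ^ 2 + (M.cell₂ σ).elim 0 fun L => v L ^ 2) * M.jump v σ ^ 2 := by
  cases h : M.cell₂ σ with
  | some L =>
    rw [M.jump_of_some _ h, M.jump_of_some _ h, Option.elim_some]
    nlinarith [mul_nonneg (sq_nonneg (v L - v (M.cell₁ σ))) (sq_nonneg (v L - v (M.cell₁ σ)))]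
  | none =>
    rw [Option.elim_none]
    by_cases hD : M.IsDirichlet σ
    · rw [M.jump_of_isDirichlet _ hD, M.jump_of_isDirichlet _ hD]
      nlinarith [mul_nonneg (sq_nonneg (v (M.cell₁ σ))) (sq_nonneg (v (M.cell₁ σ)))]
    · simp [M.jump_of_not_isDirichlet _ h hD]

/-- The `L²` Poincaré inequality follows from the `L¹` one applied to `v²`. -/
lemma l2_poincare_of_l1_poincare [Fintype T] [Fintype E] {C ζ : ℝ} (hC : 0 < C) (hζ : 0 < ζ)
    (hreg : M.IsRegular ζ)
    (h1 : ∀ w : T → ℝ, (∀ K, 0 ≤ w K) →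
      ∑ K, M.area K * w K ≤ C * ∑ σ, dist (M.a σ) (M.b σ) * |M.jump w σ|) (v : T → ℝ) :
    ∑ K, M.area K * v K ^ 2 ≤ (2 * C) ^ 2 / ζ * ∑ σ, M.trans σ * M.jump v σ ^ 2 := by
  set q : E → ℝ := fun σ => v (M.cell₁ σ) ^ 2 + (M.cell₂ σ).elim 0 fun L => v L ^ 2
  have hq : ∀ σ, 0 ≤ q σ := by
    intro σ
    refine add_nonneg (sq_nonneg _) ?_
    cases M.cell₂ σ <;> simp [sq_nonneg]
  -- Young's inequality on each edge, weighted so that the first term is absorbed below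
  have hedge : ∀ σ, C * (dist (M.a σ) (M.b σ) * |M.jump (fun K => v K ^ 2) σ|) ≤
      ζ / 4 * (dist (M.a σ) (M.b σ) * M.dEdge σ * q σ) +
        2 * C ^ 2 / ζ * (M.trans σ * M.jump v σ ^ 2) := by
    intro σ
    have hd := M.dEdge_pos σ
    have hle : C * |M.jump (fun K => v K ^ 2) σ| ≤
        ζ / 4 * (M.dEdge σ * q σ) + 2 * C ^ 2 / ζ * (M.jump v σ ^ 2 / M.dEdge σ) := by
      have hA : 0 ≤ ζ / 4 * (M.dEdge σ * q σ) :=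
        mul_nonneg (by positivity) (mul_nonneg hd.le (hq σ))
      have hB : 0 ≤ 2 * C ^ 2 / ζ * (M.jump v σ ^ 2 / M.dEdge σ) := by positivity
      have hAB : ζ / 4 * (M.dEdge σ * q σ) * (2 * C ^ 2 / ζ * (M.jump v σ ^ 2 / M.dEdge σ)) =
          C ^ 2 * (2 * q σ * M.jump v σ ^ 2) / 4 := by field_simp
      refine le_of_sq_le_sq ?_ (add_nonneg hA hB)
      rw [mul_pow, sq_abs]
      have := mul_le_mul_of_nonneg_left (M.sq_jump_sq_le v σ) (sq_nonneg C)
      nlinarith [sq_nonneg (ζ / 4 * (M.dEdge σ * q σ) -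
        2 * C ^ 2 / ζ * (M.jump v σ ^ 2 / M.dEdge σ))]
    calc _ = dist (M.a σ) (M.b σ) * (C * |M.jump (fun K => v K ^ 2) σ|) := by ring
      _ ≤ _ := mul_le_mul_of_nonneg_left hle dist_nonneg
      _ = _ := by rw [AdmissibleMesh.trans]; ring
  have hqsum : ζ * ∑ σ, dist (M.a σ) (M.b σ) * M.dEdge σ * q σ ≤
      2 * ∑ K, M.area K * v K ^ 2 := by
    have e1 : ∑ σ, dist (M.a σ) (M.b σ) * M.dEdge σ * q σ =
        ∑ K, ∑ σ ∈ M.edgesOf K, dist (M.a σ) (M.b σ) * M.dEdge σ * v K ^ 2 := by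
      rw [M.sum_sum_edgesOf]
      refine Finset.sum_congr rfl fun σ _ => ?_
      simp only [q]
      cases M.cell₂ σ <;> simp [mul_add]
    rw [e1, Finset.mul_sum, Finset.mul_sum]
    refine Finset.sum_le_sum fun K _ => ?_
    calc ζ * ∑ σ ∈ M.edgesOf K, dist (M.a σ) (M.b σ) * M.dEdge σ * v K ^ 2
        = (∑ σ ∈ M.edgesOf K, dist (M.a σ) (M.b σ) * (ζ * M.dEdge σ)) * v K ^ 2 := by
          rw [Finset.mul_sum, Finset.sum_mul]
          exact Finset.sum_congr rfl fun σ _ => by ring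
      _ ≤ (∑ σ ∈ M.edgesOf K, dist (M.a σ) (M.b σ) * M.distToEdge K σ) * v K ^ 2 := by
          gcongr with σ hσ
          exact hreg K σ hσ
      _ ≤ (2 * M.area K) * v K ^ 2 := by
          gcongr
          exact M.sum_dist_mul_distToEdge_le K
      _ = _ := by ring
  have hmain := h1 (fun K => v K ^ 2) fun K => sq_nonneg _
  rw [Finset.mul_sum] at hmain
  replace hmain := hmain.trans (Finset.sum_le_sum fun σ _ => hedge σ)
  rw [Finset.sum_add_distrib, ← Finset.mul_sum, ← Finset.mul_sum] at hmain
  have e2 : (2 * C) ^ 2 / ζ * ∑ σ, M.trans σ * M.jump v σ ^ 2 =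
    2 * (2 * C ^ 2 / ζ * ∑ σ, M.trans σ * M.jump v σ ^ 2) := by ring
  rw [e2]
  linarith

end AdmissibleMesh

/-! ### Convexity inequalities -/

lemma sinh_mul_le {θ t : ℝ} (hθ : 0 ≤ θ) (hθ1 : θ ≤ 1) (ht : 0 ≤ t) :
    Real.sinh (θ * t) ≤ θ * Real.sinh t := by
  have hder : ∀ t, HasDerivAt (fun t => θ * Real.sinh t - Real.sinh (θ * t))
      (θ * Real.cosh t - Real.cosh (θ * t) * (θ * 1)) t := fun t =>
    ((Real.hasDerivAt_sinh t).const_mul θ).sub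
      ((Real.hasDerivAt_sinh (θ * t)).comp t ((hasDerivAt_id t).const_mul θ))
  have hmono : MonotoneOn (fun t => θ * Real.sinh t - Real.sinh (θ * t)) (Set.Ici 0) := by
    refine monotoneOn_of_deriv_nonneg (convex_Ici 0)
      (fun t _ => (hder t).continuousAt.continuousWithinAt)
      (fun t _ => (hder t).differentiableAt.differentiableWithinAt) fun t ht => ?_
    rw [interior_Ici] at ht
    have ht : 0 < t := ht
    rw [(hder t).deriv]
    have : Real.cosh (θ * t) ≤ Real.cosh t := by
      rw [Real.cosh_le_cosh, abs_mul, abs_of_nonneg hθ]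
      exact mul_le_of_le_one_left (abs_nonneg t) hθ1
    nlinarith
  have := hmono (Set.mem_Ici.2 le_rfl) ht ht
  simp at this
  linarith

lemma sq_sinh_mul_le {θ : ℝ} (hθ : 0 ≤ θ) (hθ1 : θ ≤ 1) (t : ℝ) :
    Real.sinh (θ * t) ^ 2 ≤ θ ^ 2 * Real.sinh t ^ 2 := by
  wlog ht : 0 ≤ t generalizing t
  · have := this (-t) (by linarith)
    simpa using this
  rw [← mul_pow]
  exact pow_le_pow_left₀ (Real.sinh_nonneg_iff.2 (by positivity)) (sinh_mul_le hθ hθ1 ht) 2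

lemma exp_sub_exp_eq (s d : ℝ) :
    Real.exp (s + d) - Real.exp (s - d) = Real.exp s * (2 * Real.sinh d) := by
  rw [Real.sinh_eq, Real.exp_add, Real.exp_sub, Real.exp_neg]; ring

/-- The Stroock–Varopoulos inequality for two positive numbers. In logarithmic variables it reads
`sinh² (θ t) ≤ θ² sinh² t` with `θ = (2 - p) / p`. -/
lemma stroock_varopoulos {p x y : ℝ} (hp : 1 < p) (hp2 : p ≤ 2) (hx : 0 < x) (hy : 0 < y) :
    4 * (p - 1) / p ^ 2 * (x ^ (p / 2) - y ^ (p / 2)) ^ 2 ≤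
      (x - y) * (x ^ (p - 1) - y ^ (p - 1)) := by
  have hp0 : 0 < p := by linarith
  set s := (Real.log x + Real.log y) / 2
  set d := (Real.log x - Real.log y) / 2
  set θ := (2 - p) / p
  set t := p / 2 * d
  have hθ : 0 ≤ θ := div_nonneg (by linarith) hp0.le
  have hθ1 : θ ≤ 1 := (div_le_one hp0).2 (by linarith)
  have hpow : ∀ q : ℝ, x ^ q - y ^ q = Real.exp (q * s) * (2 * Real.sinh (q * d)) := by
    intro q
    rw [Real.rpow_def_of_pos hx, Real.rpow_def_of_pos hy, ← exp_sub_exp_eq]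
    congr 2 <;> simp only [s, d] <;> ring
  have h1 : x - y = Real.exp s * (2 * Real.sinh d) := by simpa using hpow 1
  have e1 : (1 + θ) * t = d := by simp only [θ, t]; field_simp; ring
  have e2 : (1 - θ) * t = (p - 1) * d := by simp only [θ, t]; field_simp; ring
  have e3 : 4 * (p - 1) / p ^ 2 = 1 - θ ^ 2 := by simp only [θ]; field_simp; ring
  have hsinh : Real.sinh d * Real.sinh ((p - 1) * d) =
      Real.sinh t ^ 2 - Real.sinh (θ * t) ^ 2 := by
    rw [← e2, ← e1, add_mul, sub_mul, one_mul, Real.sinh_add, Real.sinh_sub]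
    linear_combination Real.sinh t ^ 2 * Real.cosh_sq (θ * t) -
      Real.sinh (θ * t) ^ 2 * Real.cosh_sq t
  have hexp : Real.exp s * Real.exp ((p - 1) * s) = Real.exp (p / 2 * s) ^ 2 := by
    rw [← Real.exp_add, sq, ← Real.exp_add]; congr 1; ring
  have hR : (x - y) * (x ^ (p - 1) - y ^ (p - 1)) =
      4 * Real.exp (p / 2 * s) ^ 2 * (Real.sinh t ^ 2 - Real.sinh (θ * t) ^ 2) := by
    rw [h1, hpow, ← hsinh, ← hexp]; ring
  rw [hR, hpow, e3]
  have h2 := sq_sinh_mul_le hθ hθ1 t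
  have h3 : (1 - θ ^ 2) * (Real.exp (p / 2 * s) * (2 * Real.sinh (p / 2 * d))) ^ 2 =
    4 * Real.exp (p / 2 * s) ^ 2 * ((1 - θ ^ 2) * Real.sinh t ^ 2) := by simp only [t]; ring
  rw [h3]
  gcongr
  linarith

/-- The derivative of `Φ_p`. -/
def dPhi (p s : ℝ) : ℝ := p * (s ^ (p - 1) - 1) / (p - 1)

lemma dPhi_one (p : ℝ) : dPhi p 1 = 0 := by simp [dPhi]

/-- `Φ_p` is convex. -/
lemma Phi_add_dPhi_mul_le {p s t : ℝ} (hp : 1 < p) (hs : 0 < s) (ht : 0 ≤ t) :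
    Phi p s + dPhi p s * (t - s) ≤ Phi p t := by
  have hb := one_add_mul_self_le_rpow_one_add (s := t / s - 1) (by
    have := div_nonneg ht hs.le; linarith) hp.le
  have hts : 1 + (t / s - 1) = t / s := by ring
  rw [hts, Real.div_rpow ht hs.le, le_div_iff₀ (Real.rpow_pos_of_pos hs p)] at hb
  have hsp : s ^ p = s ^ (p - 1) * s := by
    rw [← Real.rpow_add_one hs.ne', sub_add_cancel]
  have hb' : s ^ p + p * s ^ (p - 1) * (t - s) ≤ t ^ p := by
    have : (1 + p * (t / s - 1)) * s ^ p = s ^ p + p * s ^ (p - 1) * (t - s) := by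
      rw [hsp]; field_simp
    linarith
  have hp1 : 0 < p - 1 := by linarith
  have : Phi p t - (Phi p s + dPhi p s * (t - s)) =
      (t ^ p - (s ^ p + p * s ^ (p - 1) * (t - s))) / (p - 1) := by
    simp only [Phi, dPhi]; field_simp; ring
  have h2 : 0 ≤ (t ^ p - (s ^ p + p * s ^ (p - 1) * (t - s))) / (p - 1) :=
    div_nonneg (by linarith) hp1.le
  linarith

lemma Phi_one {p : ℝ} (hp : 1 < p) : Phi p 1 = 0 := by
  have : p - 1 ≠ 0 := by linarith
  simp only [Phi, Real.one_rpow]; field_simp; ring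

lemma Phi_nonneg {p t : ℝ} (hp : 1 < p) (ht : 0 ≤ t) : 0 ≤ Phi p t := by
  have := Phi_add_dPhi_mul_le hp one_pos ht
  rwa [Phi_one hp, dPhi_one, zero_mul, add_zero] at this

lemma Phi_le {p s : ℝ} (hp : 1 < p) (hp2 : p ≤ 2) (hs : 0 < s) :
    Phi p s ≤ (s ^ (p / 2) - 1) ^ 2 / (p - 1) := by
  have hb := rpow_one_add_le_one_add_mul_self (s := s - 1) (by linarith) (p := p / 2)
    (by linarith) (by linarith)
  rw [add_sub_cancel] at hb
  have hsq : s ^ p = (s ^ (p / 2)) ^ 2 := by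
    rw [← Real.rpow_natCast, ← Real.rpow_mul hs.le]; congr 1; push_cast; ring
  have hp1 : 0 < p - 1 := by linarith
  rw [Phi, div_add_one hp1.ne', hsq]
  gcongr
  linarith

/-- Comparison of the numerical dissipation on an edge with a square: it combines the lower bound
of `r` by the logarithmic mean with the Stroock–Varopoulos inequality. -/
lemma IsMeanFunction.dissipation_le {r : ℝ → ℝ → ℝ} (hr : IsMeanFunction r) {m p x y X Y : ℝ}
    (hm : 0 < m) (hp : 1 < p) (hp2 : p ≤ 2) (hx : 0 < x) (hy : 0 < y) (hX : m * x ≤ X)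
    (hY : m * y ≤ Y) :
    4 * m / p * (x ^ (p / 2) - y ^ (p / 2)) ^ 2 ≤
      r X Y * (Real.log x - Real.log y) * (dPhi p x - dPhi p y) := by
  have hp0 : 0 < p := by linarith
  have hp1 : 0 < p - 1 := by linarith
  have hmx := mul_pos hm hx
  have hmy := mul_pos hm hy
  have hrXY : m * r x y ≤ r X Y := by
    rw [← hr.homogeneous m x y hm hx hy]
    exact (hr.mono_left _ _ _ hmx hmy hX).trans (hr.mono_right _ _ _ (hmx.trans_le hX) hmy hY)
  have hsub : dPhi p x - dPhi p y = p / (p - 1) * (x ^ (p - 1) - y ^ (p - 1)) := by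
    simp only [dPhi]; ring
  rcases eq_or_ne x y with rfl | hne
  · simp
  have hlog : Real.log x - Real.log y ≠ 0 := fun h =>
    hne (Real.log_injOn_pos hx hy (sub_eq_zero.1 h))
  have hsign : 0 ≤ (Real.log x - Real.log y) * (dPhi p x - dPhi p y) := by
    rw [hsub]
    rcases le_total x y with h | h
    · have h1 := Real.log_le_log hx h
      have h2 := Real.rpow_le_rpow hx.le h hp1.le
      exact mul_nonneg_of_nonpos_of_nonpos (by linarith)
        (mul_nonpos_of_nonneg_of_nonpos (by positivity) (by linarith))
    · have h1 := Real.log_le_log hy h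
      have h2 := Real.rpow_le_rpow hy.le h hp1.le
      exact mul_nonneg (by linarith) (mul_nonneg (by positivity) (by linarith))
  have hsv := stroock_varopoulos hp hp2 hx hy
  calc 4 * m / p * (x ^ (p / 2) - y ^ (p / 2)) ^ 2
      = m * (p / (p - 1)) * (4 * (p - 1) / p ^ 2 * (x ^ (p / 2) - y ^ (p / 2)) ^ 2) := by
        field_simp
    _ ≤ m * (p / (p - 1)) * ((x - y) * (x ^ (p - 1) - y ^ (p - 1))) := by gcongr
    _ = m * ((x - y) / (Real.log x - Real.log y)) *
        ((Real.log x - Real.log y) * (dPhi p x - dPhi p y)) := by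
        rw [hsub]; field_simp
    _ ≤ m * r x y * ((Real.log x - Real.log y) * (dPhi p x - dPhi p y)) := by
        gcongr
        exact hr.log_mean_le x y hx hy hne
    _ ≤ r X Y * ((Real.log x - Real.log y) * (dPhi p x - dPhi p y)) := by gcongr
    _ = _ := by ring

lemma kappa_pos {p ζ C m M : ℝ} (hp : 1 < p) (hζ : 0 < ζ) (hC : 0 < C) (hm : 0 < m) (hM : 0 < M) :
    0 < kappa p ζ C m M := by
  have : 0 < p - 1 := by linarith
  have : 0 < p := by linarith
  unfold kappa
  positivity

/-- By concavity of the logarithm, the decay `(1 + κ Δt)⁻ⁿ` is exponential in the time `n Δt`. -/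
lemma inv_pow_le_exp {κ Δt k : ℝ} (hκ : 0 < κ) (hΔ : 0 < Δt) (hΔk : Δt ≤ k) (n : ℕ) :
    ((1 + κ * Δt) ^ n)⁻¹ ≤ Real.exp (-(Real.log (1 + κ * k) / k) * (n * Δt)) := by
  have hk : 0 < k := hΔ.trans_le hΔk
  have h1 : (1 + κ * k) ^ (Δt / k) ≤ 1 + κ * Δt := by
    have := rpow_one_add_le_one_add_mul_self (s := κ * k)
      (by nlinarith [mul_pos hκ hk]) (p := Δt / k) (by positivity) ((div_le_one hk).2 hΔk)
    have e : Δt / k * (κ * k) = κ * Δt := by field_simp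
    rwa [e] at this
  have hpos : 0 < 1 + κ * k := by positivity
  have e1 : Real.exp (-(Real.log (1 + κ * k) / k) * (n * Δt)) =
      (((1 + κ * k) ^ (Δt / k)) ^ n)⁻¹ := by
    rw [Real.rpow_def_of_pos hpos, ← Real.exp_nat_mul, ← Real.exp_neg]
    congr 1; ring
  rw [e1]
  gcongr

lemma IsPolygonalDomain.exists_equilibrium_bounds {Ω : Set Plane} (hΩ : IsPolygonalDomain Ω)
    {V : Plane → ℝ} (hV : ContinuousOn V (closure Ω)) {ρ : ℝ} (hρ : 0 < ρ) :
    ∃ m M : ℝ, 0 < m ∧ 0 < M ∧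
      ∀ x ∈ closure Ω, m ≤ ρ * Real.exp (-V x) ∧ ρ * Real.exp (-V x) ≤ M := by
  obtain ⟨B, hB⟩ := hΩ.isCompact_closure.exists_bound_of_continuousOn hV
  refine ⟨ρ * Real.exp (-B), ρ * Real.exp B, by positivity, by positivity, fun x hx => ?_⟩
  have := abs_le.1 (hB x hx)
  constructor <;> gcongr <;> linarith

/-! ### Entropy dissipation -/

namespace AdmissibleMesh

variable {Ω ΓD ΓN : Set Plane} {T E : Type} (M : AdmissibleMesh Ω ΓD ΓN T E)

lemma flux_of_not_isDirichlet (r : ℝ → ℝ → ℝ) (V : Plane → ℝ) (w : T → ℝ) (g : E → ℝ) (K : T)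
    {σ : E} (h : M.cell₂ σ = none) (hD : ¬ M.IsDirichlet σ) : M.flux r V w g K σ = 0 := by
  simp [flux, diff, neighbor, h, hD]

/-- The numerical fluxes are conservative. -/
lemma flux_neighbor {r : ℝ → ℝ → ℝ} (hr : IsMeanFunction r) (V : Plane → ℝ) {w : T → ℝ}
    (hw : ∀ K, 0 < w K) (g : E → ℝ) {σ : E} {L : T} (h : M.cell₂ σ = some L) :
    M.flux r V w g L σ = -M.flux r V w g (M.cell₁ σ) σ := by
  have hne : M.cell₁ σ ≠ L := fun h' => M.cell₂_ne σ (by rw [h, h'])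
  simp only [flux, diff, neighbor, h, hne, if_true, if_false]
  rw [hr.symm _ _ (hw L) (hw _)]
  ring

/-- Discrete integration by parts. -/
lemma sum_mul_sum_flux [Fintype T] [Fintype E] {r : ℝ → ℝ → ℝ} (hr : IsMeanFunction r)
    (V : Plane → ℝ) {w : T → ℝ} (hw : ∀ K, 0 < w K) (g : E → ℝ) (ψ : T → ℝ) :
    ∑ K, ψ K * ∑ σ ∈ M.edgesOf K, M.flux r V w g K σ =
      ∑ σ, -(M.flux r V w g (M.cell₁ σ) σ * M.jump ψ σ) := by
  simp_rw [Finset.mul_sum]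
  rw [M.sum_sum_edgesOf]
  refine Finset.sum_congr rfl fun σ _ => ?_
  cases h : M.cell₂ σ with
  | some L =>
    rw [Option.elim_some, M.flux_neighbor hr V hw g h, M.jump_of_some ψ h]; ring
  | none =>
    rw [Option.elim_none]
    by_cases hD : M.IsDirichlet σ
    · rw [M.jump_of_isDirichlet ψ hD]; ring
    · simp [M.flux_of_not_isDirichlet r V w g _ h hD]

lemma equilibrium_pos {ρ : ℝ} (hρ : 0 < ρ) (V : Plane → ℝ) (K : T) :
    0 < M.equilibrium ρ V K := by
  unfold equilibrium; positivity

lemma log_add_potential {ρ x v : ℝ} (hρ : 0 < ρ) (hx : 0 < x) :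
    Real.log x + v = Real.log (x / (ρ * Real.exp (-v))) + Real.log ρ := by
  rw [Real.log_div hx.ne' (by positivity), Real.log_mul hρ.ne' (Real.exp_pos _).ne', Real.log_exp]
  ring

lemma edgeCenter_mem (σ : E) : M.edgeCenter σ ∈ openSegment ℝ (M.a σ) (M.b σ) := by
  rw [openSegment_eq_image']
  refine ⟨1 / 2, by norm_num, ?_⟩
  rw [edgeCenter, midpoint_eq_smul_add, invOf_eq_inv]
  module

lemma edge_dissipation_le {r : ℝ → ℝ → ℝ} (hr : IsMeanFunction r) {V uD : Plane → ℝ} {ρ : ℝ}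
    (hρ : 0 < ρ) (huD : ∀ x ∈ ΓD, uD x = ρ * Real.exp (-V x)) {m p : ℝ} (hm : 0 < m)
    (hp : 1 < p) (hp2 : p ≤ 2) (hmK : ∀ K, m ≤ M.equilibrium ρ V K)
    (hmσ : ∀ σ, M.IsDirichlet σ → m ≤ M.edgeEquilibrium ρ V σ) {w : T → ℝ} (hw : ∀ K, 0 < w K)
    (σ : E) :
    4 * m / p * (M.trans σ *
        M.jump (fun K => (w K / M.equilibrium ρ V K) ^ (p / 2) - 1) σ ^ 2) ≤
      -(M.flux r V w (fun s => uD (M.edgeCenter s)) (M.cell₁ σ) σ *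
        M.jump (fun K => dPhi p (w K / M.equilibrium ρ V K)) σ) := by
  have hquot : ∀ K, 0 < w K / M.equilibrium ρ V K := fun K =>
    div_pos (hw K) (M.equilibrium_pos hρ V K)
  have hmul : ∀ K, m * (w K / M.equilibrium ρ V K) ≤ w K := fun K => by
    rw [mul_div_assoc', div_le_iff₀ (M.equilibrium_pos hρ V K), mul_comm]
    exact mul_le_mul_of_nonneg_left (hmK K) (hw K).le
  have hτ := (M.trans_pos σ).le
  have hlog : ∀ K, Real.log (w K) + V (M.center K) =
      Real.log (w K / M.equilibrium ρ V K) + Real.log ρ := fun K => log_add_potential hρ (hw K)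
  cases h : M.cell₂ σ with
  | some L =>
    have := mul_le_mul_of_nonneg_left
      (hr.dissipation_le hm hp hp2 (hquot (M.cell₁ σ)) (hquot L) (hmul _) (hmul L)) hτ
    rw [M.jump_of_some _ h, M.jump_of_some _ h]
    simp only [flux, diff, neighbor, h, if_true, hlog]
    refine (le_of_eq_of_le ?_ this).trans_eq ?_ <;> ring
  | none =>
    by_cases hD : M.IsDirichlet σ
    · have hg : uD (M.edgeCenter σ) = M.edgeEquilibrium ρ V σ :=
        huD _ (hD.2 (M.edgeCenter_mem σ))
      have hepos : 0 < M.edgeEquilibrium ρ V σ := hm.trans_le (hmσ σ hD)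
      have hlogσ : Real.log (M.edgeEquilibrium ρ V σ) + V (M.edgeCenter σ) = Real.log ρ := by
        rw [log_add_potential hρ hepos, edgeEquilibrium, div_self (by positivity), Real.log_one,
          zero_add]
      have := mul_le_mul_of_nonneg_left
        (hr.dissipation_le hm hp hp2 (hquot (M.cell₁ σ)) one_pos (hmul _)
          (Y := M.edgeEquilibrium ρ V σ) (by rw [mul_one]; exact hmσ σ hD)) hτ
      rw [Real.one_rpow, Real.log_one, dPhi_one] at this
      rw [M.jump_of_isDirichlet _ hD, M.jump_of_isDirichlet _ hD]
      simp only [flux, diff, neighbor, h, if_pos hD, hlog, hg, hlogσ]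
      refine (le_of_eq_of_le ?_ this).trans_eq ?_ <;> ring
    · simp [M.jump_of_not_isDirichlet _ h hD]

lemma entropy_nonneg [Fintype T] {ρ p : ℝ} (hρ : 0 < ρ) (V : Plane → ℝ) (hp : 1 < p) {w : T → ℝ}
    (hw : ∀ K, 0 ≤ w K) : 0 ≤ M.entropy ρ V p w :=
  Finset.sum_nonneg fun K _ =>
    mul_nonneg (mul_nonneg (M.area_nonneg K) (M.equilibrium_pos hρ V K).le)
      (Phi_nonneg hp (div_nonneg (hw K) (M.equilibrium_pos hρ V K).le))

lemma entropy_le [Fintype T] {ρ p B : ℝ} (hρ : 0 < ρ) (V : Plane → ℝ) (hp : 1 < p) (hp2 : p ≤ 2)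
    (hB : ∀ K, M.equilibrium ρ V K ≤ B) {w : T → ℝ} (hw : ∀ K, 0 < w K) :
    M.entropy ρ V p w ≤
      B / (p - 1) * ∑ K, M.area K * ((w K / M.equilibrium ρ V K) ^ (p / 2) - 1) ^ 2 := by
  have hp1 : 0 < p - 1 := by linarith
  rw [entropy, Finset.mul_sum]
  refine Finset.sum_le_sum fun K _ => ?_
  have he := M.equilibrium_pos hρ V K
  have ha := M.area_nonneg K
  calc _ ≤ M.area K * B * (((w K / M.equilibrium ρ V K) ^ (p / 2) - 1) ^ 2 / (p - 1)) := by
        have h0 := Phi_nonneg hp (div_pos (hw K) he).le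
        have h1 := Phi_le hp hp2 (div_pos (hw K) he)
        have h2 := hB K
        have hB0 : 0 ≤ B := he.le.trans h2
        gcongr
    _ = _ := by ring

/-- Convexity of `Φ_p` and the scheme: the entropy decreases by at least the dissipation. -/
lemma entropy_sub_le [Fintype T] [Fintype E] {r : ℝ → ℝ → ℝ} (hr : IsMeanFunction r)
    {V : Plane → ℝ} {ρ : ℝ} (hρ : 0 < ρ) {p Δt : ℝ} (hp : 1 < p) (hΔ : 0 < Δt)
    {w w₀ : T → ℝ} (hw : ∀ K, 0 < w K) (hw₀ : ∀ K, 0 ≤ w₀ K) (g : E → ℝ)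
    (hstep : ∀ K, M.area K * ((w K - w₀ K) / Δt) + ∑ σ ∈ M.edgesOf K, M.flux r V w g K σ = 0) :
    M.entropy ρ V p w + Δt * ∑ σ, -(M.flux r V w g (M.cell₁ σ) σ *
      M.jump (fun K => dPhi p (w K / M.equilibrium ρ V K)) σ) ≤ M.entropy ρ V p w₀ := by
  rw [← M.sum_mul_sum_flux hr V hw g, Finset.mul_sum, entropy, entropy, ← Finset.sum_add_distrib]
  refine Finset.sum_le_sum fun K _ => ?_
  have he := M.equilibrium_pos hρ V K
  have hc := Phi_add_dPhi_mul_le hp (div_pos (hw K) he) (div_nonneg (hw₀ K) he.le)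
  have hfl : ∑ σ ∈ M.edgesOf K, M.flux r V w g K σ = -(M.area K * ((w K - w₀ K) / Δt)) := by
    linarith [hstep K]
  rw [hfl]
  refine le_of_eq_of_le ?_ (mul_le_mul_of_nonneg_left hc
    (mul_nonneg (M.area_nonneg K) he.le))
  field_simp
  ring

lemma IsSolution.nonneg [Fintype E] {M : AdmissibleMesh Ω ΓD ΓN T E} {r : ℝ → ℝ → ℝ}
    {V uD u₀ : Plane → ℝ} {Δt : ℝ} {u : ℕ → T → ℝ} (hu : M.IsSolution r V uD u₀ Δt u)
    (hu₀ : ∀ᵐ x ∂(volume.restrict Ω), 0 ≤ u₀ x) (n : ℕ) (K : T) : 0 ≤ u n K := by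
  cases n with
  | zero =>
    rw [hu.initial K]
    exact mul_nonneg (one_div_nonneg.2 (M.area_nonneg K))
      (setIntegral_nonneg_of_ae_restrict (ae_restrict_of_ae_restrict_of_subset
        (M.cell_subset K) hu₀))
  | succ n => exact (hu.pos n K).le

/-- One time step contracts the entropy by the factor `(1 + κ Δt)⁻¹`. -/
lemma IsSolution.entropy_succ_le [Fintype T] [Fintype E] {M : AdmissibleMesh Ω ΓD ΓN T E}
    {r : ℝ → ℝ → ℝ} (hr : IsMeanFunction r) {V uD u₀ : Plane → ℝ} {Δt : ℝ} {u : ℕ → T → ℝ}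
    (hu : M.IsSolution r V uD u₀ Δt u) (hu₀ : ∀ᵐ x ∂(volume.restrict Ω), 0 ≤ u₀ x) (hΔ : 0 < Δt)
    {ρ m B p ζ C : ℝ} (hρ : 0 < ρ) (huD : ∀ x ∈ ΓD, uD x = ρ * Real.exp (-V x)) (hm : 0 < m)
    (hp : 1 < p) (hp2 : p ≤ 2) (hζ : 0 < ζ) (hC : 0 < C) (hmB : m ≤ B)
    (hK : ∀ K, m ≤ M.equilibrium ρ V K ∧ M.equilibrium ρ V K ≤ B)
    (hmσ : ∀ σ, M.IsDirichlet σ → m ≤ M.edgeEquilibrium ρ V σ)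
    (hpoinc : ∀ v : T → ℝ,
      ∑ K, M.area K * v K ^ 2 ≤ C ^ 2 / ζ * ∑ σ, M.trans σ * M.jump v σ ^ 2) (n : ℕ) :
    (1 + kappa p ζ C m B * Δt) * M.entropy ρ V p (u (n + 1)) ≤ M.entropy ρ V p (u n) := by
  have hB : 0 < B := hm.trans_le hmB
  have hp1 : 0 < p - 1 := by linarith
  have hp0 : 0 < p := by linarith
  have hpos := hu.pos n
  set v : T → ℝ := fun K => (u (n + 1) K / M.equilibrium ρ V K) ^ (p / 2) - 1
  set N := ∑ σ, M.trans σ * M.jump v σ ^ 2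
  have hN : 0 ≤ N := Finset.sum_nonneg fun σ _ => mul_nonneg (M.trans_pos σ).le (sq_nonneg _)
  have h1 := M.entropy_sub_le hr hρ hp hΔ hpos (hu.nonneg hu₀ n) _ (hu.step n)
  have h2 : 4 * m / p * N ≤ ∑ σ, -(M.flux r V (u (n + 1)) (fun s => uD (M.edgeCenter s))
      (M.cell₁ σ) σ * M.jump (fun K => dPhi p (u (n + 1) K / M.equilibrium ρ V K)) σ) := by
    rw [Finset.mul_sum]
    exact Finset.sum_le_sum fun σ _ =>
      M.edge_dissipation_le hr hρ huD hm hp hp2 (fun K => (hK K).1) hmσ hpos σ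
  have h3 : M.entropy ρ V p (u (n + 1)) ≤ B / (p - 1) * (C ^ 2 / ζ * N) :=
    (M.entropy_le hρ V hp hp2 (fun K => (hK K).2) hpos).trans
      (mul_le_mul_of_nonneg_left (hpoinc v) (by positivity))
  have h4 : kappa p ζ C m B * M.entropy ρ V p (u (n + 1)) ≤ 4 * m / p * N := by
    -- as `m / B ≤ 1` and `p ≥ 1`, the power `(m / B) ^ p` is at most `m / B`
    have hpow : (m / B) ^ p ≤ m / B := by
      have := Real.rpow_le_rpow_of_exponent_ge (x := m / B) (by positivity)
        ((div_le_one hB).2 hmB) hp.le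
      rwa [Real.rpow_one] at this
    calc _ ≤ kappa p ζ C m B * (B / (p - 1) * (C ^ 2 / ζ * N)) :=
          mul_le_mul_of_nonneg_left h3 (kappa_pos hp hζ hC hm hB).le
      _ ≤ 4 * (p - 1) / p * (ζ / C ^ 2) * (m / B) * (B / (p - 1) * (C ^ 2 / ζ * N)) := by
          unfold kappa
          gcongr
      _ = _ := by field_simp
  have h5 := mul_le_mul_of_nonneg_left (h4.trans h2) hΔ.le
  linarith

end AdmissibleMesh

end TPFA

end

/-! ### Exponential decay -/

theorem theorem3p2 (Ω ΓD : Set TPFA.Plane) (hΩ : TPFA.IsPolygonalDomain Ω) :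
    -- the constant depends only on the domain and on the Dirichlet part of its boundary
    ∃ C : ℝ, 0 < C ∧
      ∀ (V : TPFA.Plane → ℝ) (ρ : ℝ), TPFA.IsC1UpToBoundary Ω V → 0 < ρ →
        -- bounds of the equilibrium that are valid for all meshes
        (∃ m M : ℝ, 0 < m ∧ 0 < M ∧
          ∀ x ∈ closure Ω, m ≤ ρ * Real.exp (-V x) ∧ ρ * Real.exp (-V x) ≤ M) ∧
        ∀ m M p ζ : ℝ, 0 < m → 0 < M → 1 < p → p ≤ 2 → 0 < ζ →
          0 < TPFA.kappa p ζ C m M ∧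
          ∀ (ΓN : Set TPFA.Plane) (T E : Type) [Fintype T] [Fintype E]
            (mesh : TPFA.AdmissibleMesh Ω ΓD ΓN T E)
            (r : ℝ → ℝ → ℝ) (uD u₀ : TPFA.Plane → ℝ) (Δt : ℝ) (u : ℕ → T → ℝ),
            TPFA.IsBoundarySplitting Ω ΓD ΓN →
            mesh.IsRegular ζ →
            (∃ σ, mesh.IsDirichlet σ) →
            (∀ K, m ≤ mesh.equilibrium ρ V K ∧ mesh.equilibrium ρ V K ≤ M) →
            (∀ σ, mesh.IsDirichlet σ → m ≤ mesh.edgeEquilibrium ρ V σ) →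
            TPFA.IsMeanFunction r →
            (∀ x ∈ ΓD, uD x = ρ * Real.exp (-V x)) →
            MeasureTheory.MemLp u₀ 2 (MeasureTheory.volume.restrict Ω) →
            (∀ᵐ x ∂(MeasureTheory.volume.restrict Ω), 0 ≤ u₀ x) →
            0 < Δt →
            mesh.IsSolution r V uD u₀ Δt u →
            (∀ n : ℕ, mesh.entropy ρ V p (u n) ≤
              ((1 + TPFA.kappa p ζ C m M * Δt) ^ n)⁻¹ * mesh.entropy ρ V p (u 0)) ∧
            ∀ k : ℝ, 0 < k → Δt ≤ k → ∀ n : ℕ, mesh.entropy ρ V p (u n) ≤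
              Real.exp (-(Real.log (1 + TPFA.kappa p ζ C m M * k) / k) * (n * Δt)) *
                mesh.entropy ρ V p (u 0) := by

  obtain ⟨C₁, hC₁, hpoinc⟩ := TPFA.exists_l1_poincare (ΓD := ΓD) hΩ
  have hC : 0 < 2 * C₁ := by positivity
  refine ⟨2 * C₁, hC, fun V ρ hV hρ => ⟨hΩ.exists_equilibrium_bounds hV.2.1 hρ, ?_⟩⟩
  intro m M p ζ hm hM hp hp2 hζ
  have hκ := TPFA.kappa_pos hp hζ hC hm hM
  refine ⟨hκ, ?_⟩
  intro ΓN T E _ _ mesh r uD u₀ Δt u hΓ hreg hdir hK hσ hr huD _ hu₀ hΔ hu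
  have hmM : m ≤ M := by
    obtain ⟨σ, -⟩ := hdir
    exact (hK (mesh.cell₁ σ)).1.trans (hK (mesh.cell₁ σ)).2
  have hdecay : ∀ n : ℕ, mesh.entropy ρ V p (u n) ≤
      ((1 + TPFA.kappa p ζ (2 * C₁) m M * Δt) ^ n)⁻¹ * mesh.entropy ρ V p (u 0) := by
    have hpos : 0 < 1 + TPFA.kappa p ζ (2 * C₁) m M * Δt := by positivity
    intro n
    induction n with
    | zero => simp
    | succ n ih =>
      have hstep := hu.entropy_succ_le hr hu₀ hΔ hρ huD hm hp hp2 hζ hC hmM hK hσ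
        (mesh.l2_poincare_of_l1_poincare hC₁ hζ hreg (hpoinc ΓN T E mesh hΓ hdir)) n
      rw [← div_eq_inv_mul, le_div_iff₀ (by positivity)] at ih ⊢
      calc _ = (1 + TPFA.kappa p ζ (2 * C₁) m M * Δt) * mesh.entropy ρ V p (u (n + 1)) *
            (1 + TPFA.kappa p ζ (2 * C₁) m M * Δt) ^ n := by ring
        _ ≤ mesh.entropy ρ V p (u n) * (1 + TPFA.kappa p ζ (2 * C₁) m M * Δt) ^ n := by gcongr
        _ ≤ _ := ih
  refine ⟨hdecay, fun k _ hΔk n => (hdecay n).trans ?_⟩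
  exact mul_le_mul_of_nonneg_right (TPFA.inv_pow_le_exp hκ hΔ hΔk n)
    (mesh.entropy_nonneg hρ V hp (hu.nonneg hu₀ 0))
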